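/- Let $\mathcal X,\mathcal Y$ (inputs, non-empty) and $\mathcal A,\mathcal B$ (outcomes) be finite sets. A conditional distribution $p(a,b|x,y)$ is *non-signaling* if $\sum_b p(a,b|x,y)$ does not depend on $y$ and $\sum_a p(a,b|x,y)$ does not depend on $x$. It is *local* if it is a convex combination of distributions $\delta_{a=\lambda_A(x)}\delta_{b=\lambda_B(y)}$ with $\lambda_A:\mathcal X\to\mathcal A$, $\lambda_B:\mathcal Y\to\mathcal B$. It is *quantum* if $p(a,b|x,y)=\langle\psi|E_a(x)F_b(y)|\psi\rangle$ for a unit vector $\psi$ of a complex Hilbert space and projective measurements $\{E_a(x)\}_a$, $\{F_b(y)\}_b$ with $E_a(x)F_b(y)=F_b(y)E_a(x)$. Let $\mathcal L$ and $\mathcal Q$ be the sets of local and of quantum distributions, and let $\delta(\mathbf p,\mathbf p')=\max_{x,y,\mathcal E\subseteq\mathcal A\times\mathcal B}|p(\mathcal E|x,y)-p'(\mathcal E|x,y)|$. For a non-signaling $\mathbf p$ and $\epsilon\ge 0$ put $$\tilde\nu(\mathbf p)=\inf\Big\{\sum_i|q_i| : \mathbf p=\sum_i q_i\mathbf p_i,\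 q_i\in\mathbb R,\ \mathbf p_i\in\mathcal L\Big\},\qquad \tilde\gamma_2(\mathbf p)=\inf\Big\{\sum_i|q_i| : \mathbf p=\sum_i q_i\mathbf p_i,\ q_i\in\mathbb R,\ \mathbf p_i\in\mathcal Q\Big\}$$ (finite sums), and let $\tilde\nu^\epsilon(\mathbf p)$, $\tilde\gamma_2^\epsilon(\mathbf p)$ be the infima of $\tilde\nu(\mathbf p')$, $\tilde\gamma_2(\mathbf p')$ over the non-signaling $\mathbf p'$ with $\delta(\mathbf p,\mathbf p')\le\epsilon$. Let $R_0^{\mathrm{pub}}(\mathbf p)$ be the least number $t$ such that some classical two-party protocol with shared randomness and at most $t$ bits of communication, in which on inputs $x,y$ Alice outputs $a$ and Bob outputs $b$, has output distribution exactly $p(a,b|x,y)$. Let $Q_0^{\mathrm{ent}}(\mathbf p)$ be the least number $q$ of qubits of communication with which $\mathbf p$ can be simulated exactly by a quantum protocol with shared entanglement: the players share a state of a Hilbert space on which the operators of Alice commute with those of Bob (for example a tensor product of two registers, of any dimension), in every round a prescribed player applies a unitary to his own part and sends one qubit to the other player, and in the end each player measures his own part. Let $R_\epsilon^{\mathrm{pub}}(\mathbf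 p)$, $Q_\epsilon^{\mathrm{ent}}(\mathbf p)$ be the minima of $R_0^{\mathrm{pub}}(\mathbf p')$, $Q_0^{\mathrm{ent}}(\mathbf p')$ over the non-signaling $\mathbf p'$ with $\delta(\mathbf p,\mathbf p')\le\epsilon$. For $C:\mathcal X\times\mathcal Y\to[-1,1]$ identify $C$ with the distribution with outcomes $a,b\in\{\pm1\}$, uniform marginals and correlations $C$, that is, $p(a,b|x,y)=\frac14(1+ab\,C(x,y))$. Then, for every non-signaling $\mathbf p$, every $C:\mathcal X\times\mathcal Y\to[-1,1]$ and every $\epsilon\ge0$, with logarithms to base $2$: 1. $R_0^{\mathrm{pub}}(\mathbf p)\ge\log\tilde\nu(\mathbf p)-1$ and $R_\epsilon^{\mathrm{pub}}(\mathbf p)\ge\log\tilde\nu^\epsilon(\mathbf p)-1$; 2. $Q_0^{\mathrm{ent}}(\mathbf p)\ge\frac12\log\tilde\gamma_2(\mathbf p)-1$ and $Q_\epsilon^{\mathrm{ent}}(\mathbf p)\ge\frac12\log\tilde\gamma_2^\epsilon(\mathbf p)-1$; 3. $Q_0^{\mathrm{ent}}(C)\ge\log\tilde\gamma_2(C)$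 and $Q_\epsilon^{\mathrm{ent}}(C)\ge\log\tilde\gamma_2^\epsilon(C)$. -/

import Mathlib

open scoped BigOperators

noncomputable section

/-! ### Bipartite conditional distributions

`p x y a b` is the probability `p(a,b|x,y)` of outcomes `a, b` on inputs `x, y`. -/

/-- Real tables indexed by inputs and outcomes, as a real vector space. -/
abbrev Table (X Y A B : Type*) : Type _ := X → Y → A → B → ℝ

/-- `p` is a non-signaling conditional distribution. -/
structure NonSignaling {X Y A B : Type*} [Fintype A] [Fintype B] (p : Table X Y A B) : Prop where
  nonneg : ∀ x y a b, 0 ≤ p x y a b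
  sum_eq_one : ∀ x y, ∑ a, ∑ b, p x y a b = 1
  alice : ∀ a x y y', ∑ b, p x y a b = ∑ b, p x y' a b
  bob : ∀ b x x' y, ∑ a, p x y a b = ∑ a, p x' y a b

/-- The statistical distance: the largest difference of the probabilities of an event, over all
inputs and all events. -/
def tvDist {X Y A B : Type*} (p p' : Table X Y A B) : ℝ :=
  ⨆ z : X × Y × Finset (A × B),
    |∑ e ∈ z.2.2, p z.1 z.2.1 e.1 e.2 - ∑ e ∈ z.2.2, p' z.1 z.2.1 e.1 e.2|

/-- The binary distribution `(C, 0, 0)` with correlations `C` and uniform marginals; the outcomes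
are `±1`, that is, the elements of `ℤˣ`. -/
def uniformMarginals {X Y : Type*} (C : X → Y → ℝ) : Table X Y ℤˣ ℤˣ :=
  fun x y a b => (1 + ((a : ℤ) : ℝ) * ((b : ℤ) : ℝ) * C x y) / 4

/-! ### Local and quantum distributions -/

open Classical in
/-- The local deterministic distribution given by the two output functions. -/
def localDet {X Y A B : Type*} (l : (X → A) × (Y → B)) : Table X Y A B :=
  fun x y a b => (if a = l.1 x then 1 else 0) * (if b = l.2 y then 1 else 0)

/-- Local distributions: convex combinations of local deterministic ones. -/
def localSet (X Y A B : Type*) : Set (Table X Y A B) :=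
  convexHull ℝ (Set.range localDet)

open Classical in
/-- A complete family of mutually orthogonal self-adjoint projections, indexed by outcomes. -/
structure IsProjMeas {A R : Type*} [Fintype A] [Ring R] [StarRing R] (E : A → R) : Prop where
  selfAdjoint : ∀ a, star (E a) = E a
  mul_eq : ∀ a a', E a * E a' = if a = a' then E a else 0
  sum_eq_one : ∑ a, E a = 1

/-- Quantum distributions: those obtained by commuting projective measurements of a pure state in
a complex Hilbert space (of arbitrary dimension). -/
def quantumSet (X Y A B : Type*) [Fintype A] [Fintype B] : Set (Table X Y A B) :=
  {p | ∃ (H : Type) (_ : NormedAddCommGroup H) (_ : InnerProductSpace ℂ H) (_ : CompleteSpace H)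
      (ψ : H) (E : X → A → H →L[ℂ] H) (F : Y → B → H →L[ℂ] H),
      ‖ψ‖ = 1 ∧ (∀ x, IsProjMeas (E x)) ∧ (∀ y, IsProjMeas (F y)) ∧
      (∀ x y a b, E x a * F y b = F y b * E x a) ∧
      ∀ x y a b, (p x y a b : ℂ) = inner ℂ ψ ((E x a * F y b) ψ)}

/-! ### Affine models -/

/-- The least `∑ |qᵢ|` over the finite representations `p = ∑ qᵢ pᵢ` with real `qᵢ` and
`pᵢ ∈ S`. -/
def affineCost {X Y A B : Type*} (S : Set (Table X Y A B)) (p : Table X Y A B) : ℝ :=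
  sInf {s | ∃ (n : ℕ) (q : Fin n → ℝ) (P : Fin n → Table X Y A B),
    (∀ i, P i ∈ S) ∧ p = ∑ i, q i • P i ∧ s = ∑ i, |q i|}

/-- The least value of `affineCost S` on the non-signaling distributions at statistical distance
at most `ε` from `p`. -/
def affineCostApprox {X Y A B : Type*} [Fintype A] [Fintype B] (S : Set (Table X Y A B))
    (ε : ℝ) (p : Table X Y A B) : ℝ :=
  sInf {s | ∃ p' : Table X Y A B, NonSignaling p' ∧ tvDist p p' ≤ ε ∧ s = affineCost S p'}

/-- `ν̃(p)` -/
def nuTilde {X Y A B : Type*} (p : Table X Y A B) : ℝ :=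
  affineCost (localSet X Y A B) p

/-- `ν̃^ε(p)` -/
def nuTildeApprox {X Y A B : Type*} [Fintype A] [Fintype B] (ε : ℝ) (p : Table X Y A B) : ℝ :=
  affineCostApprox (localSet X Y A B) ε p

/-- `γ̃₂(p)` -/
def gammaTilde {X Y A B : Type*} [Fintype A] [Fintype B] (p : Table X Y A B) : ℝ :=
  affineCost (quantumSet X Y A B) p

/-- `γ̃₂^ε(p)` -/
def gammaTildeApprox {X Y A B : Type*} [Fintype A] [Fintype B] (ε : ℝ) (p : Table X Y A B) : ℝ :=
  affineCostApprox (quantumSet X Y A B) ε p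

/-! ### Classical protocols with public randomness -/

/-- Deterministic two-party protocols, as trees: at an inner node one player sends a bit that
depends on his own input (and, through the node, on the transcript); at a leaf each player
produces an outcome that depends on his own input (and on the transcript). -/
inductive CProtocol (X Y A B : Type*)
  | output (outA : X → A) (outB : Y → B) : CProtocol X Y A B
  | aliceSends (bit : X → Bool) (next : Bool → CProtocol X Y A B) : CProtocol X Y A B
  | bobSends (bit : Y → Bool) (next : Bool → CProtocol X Y A B) : CProtocol X Y A B

/-- The number of bits exchanged in the worst case. -/
def CProtocol.cost {X Y A B : Type*} : CProtocol X Y A B → ℕ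
  | .output _ _ => 0
  | .aliceSends _ next => 1 + max (next false).cost (next true).cost
  | .bobSends _ next => 1 + max (next false).cost (next true).cost

/-- The pair of outcomes on given inputs. -/
def CProtocol.run {X Y A B : Type*} : CProtocol X Y A B → X → Y → A × B
  | .output outA outB, x, y => (outA x, outB y)
  | .aliceSends bit next, x, y => (next (bit x)).run x y
  | .bobSends bit next, x, y => (next (bit y)).run x y

/-- `p` is the output distribution of a public-coin protocol, that is, of a probability
distribution `μ` on deterministic protocols, with at most `t` bits of communication. Private
coins are covered, as parts of the public one. -/
def ClassicalSim {X Y A B : Type*} (t : ℕ) (p : Table X Y A B) : Prop :=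
  ∃ μ : PMF (CProtocol X Y A B), (∀ P ∈ μ.support, P.cost ≤ t) ∧
    ∀ x y a b, p x y a b = ((μ.map fun P => P.run x y) (a, b)).toReal

/-! ### Quantum protocols with shared entanglement -/

/-- The two players. -/
inductive Party
  | alice
  | bob

/-- Operators on `H ⊗ (ℂ²)^{⊗ q}`, written as matrices of operators on `H` in the computational
basis `{0,1}^q` of the `q` qubits. -/
abbrev QOp (q : ℕ) (H : Type*) [NormedAddCommGroup H] [InnerProductSpace ℂ H] : Type _ :=
  Matrix (Fin q → Bool) (Fin q → Bool) (H →L[ℂ] H)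

/-- `M` belongs to `𝒜 ⊗ B((ℂ²)^{⊗ S}) ⊗ 1`: it acts on `H` through the algebra `𝒜`, acts on the
qubits of `S`, and is the identity on all other qubits. -/
structure ActsOn {q : ℕ} {H : Type*} [NormedAddCommGroup H] [InnerProductSpace ℂ H]
    [CompleteSpace H] (𝒜 : StarSubalgebra ℂ (H →L[ℂ] H)) (S : Set (Fin q)) (M : QOp q H) :
    Prop where
  mem : ∀ s t, M s t ∈ 𝒜
  eq_zero : ∀ s t, (∃ i, i ∉ S ∧ s i ≠ t i) → M s t = 0
  eq_of_agree : ∀ s t s' t', (∀ i ∈ S, s i = s' i ∧ t i = t' i) →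
    (∀ i, i ∉ S → s i = t i ∧ s' i = t' i) → M s t = M s' t'

/-- Quantum protocols with shared entanglement and `q` qubits of communication. The players share
a pure state `ψ` of a Hilbert space `H`. Alice and Bob can act on `H` through the commuting
algebras `algA` and `algB` (in the tensor product setting `H = H_A ⊗ H_B` these are
`B(H_A) ⊗ 1` and `1 ⊗ B(H_B)`). The `i`-th communicated qubit starts in the state `|0⟩` in the
hands of `sender i`. In round `i` this player applies a unitary, depending on his input, to his
part of `H`, to the qubits that he received in earlier rounds and to qubit `i`, which is then
handed to the other player. In the end each player measures his part of `H` together with all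
the qubits that he has received. -/
structure QProtocol (X Y A B : Type*) [Fintype A] [Fintype B] (q : ℕ) (H : Type*)
    [NormedAddCommGroup H] [InnerProductSpace ℂ H] [CompleteSpace H] where
  ψ : H
  norm_ψ : ‖ψ‖ = 1
  algA : StarSubalgebra ℂ (H →L[ℂ] H)
  algB : StarSubalgebra ℂ (H →L[ℂ] H)
  commute : ∀ S ∈ algA, ∀ T ∈ algB, S * T = T * S
  sender : Fin q → Party
  opA : X → Fin q → QOp q H
  opB : Y → Fin q → QOp q H
  opA_unitary : ∀ x i, sender i = .alice → opA x i ∈ unitary (QOp q H)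
  opB_unitary : ∀ y i, sender i = .bob → opB y i ∈ unitary (QOp q H)
  opA_acts : ∀ x i, sender i = .alice →
    ActsOn algA ({j | j < i ∧ sender j = .bob} ∪ {i}) (opA x i)
  opB_acts : ∀ y i, sender i = .bob →
    ActsOn algB ({j | j < i ∧ sender j = .alice} ∪ {i}) (opB y i)
  measA : X → A → QOp q H
  measB : Y → B → QOp q H
  measA_proj : ∀ x, IsProjMeas (measA x)
  measB_proj : ∀ y, IsProjMeas (measB y)
  measA_acts : ∀ x a, ActsOn algA {j | sender j = .bob} (measA x a)
  measB_acts : ∀ y b, ActsOn algB {j | sender j = .alice} (measB y b)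

namespace QProtocol

variable {X Y A B : Type*} [Fintype A] [Fintype B] {q : ℕ} {H : Type*}
  [NormedAddCommGroup H] [InnerProductSpace ℂ H] [CompleteSpace H]

/-- The unitary applied in round `i`. -/
def roundOp (π : QProtocol X Y A B q H) (x : X) (y : Y) (i : Fin q) : QOp q H :=
  match π.sender i with
  | .alice => π.opA x i
  | .bob => π.opB y i

/-- The product of all rounds, the first one acting first. -/
def totalOp (π : QProtocol X Y A B q H) (x : X) (y : Y) : QOp q H :=
  (List.ofFn fun i => π.roundOp x y i).reverse.prod

/-- The probability of the outcomes `a, b`: the expectation of the product of the two projections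
in the final state `W (ψ ⊗ |0…0⟩)`. -/
def prob (π : QProtocol X Y A B q H) (x : X) (y : Y) (a : A) (b : B) : ℂ :=
  inner ℂ π.ψ
    ((star (π.totalOp x y) * (π.measA x a * π.measB y b) * π.totalOp x y)
      (fun _ => false) (fun _ => false) π.ψ)

end QProtocol

/-- `p` is the output distribution of an entanglement-assisted quantum protocol with `q` qubits of
communication. -/
def QuantumSim {X Y A B : Type*} [Fintype A] [Fintype B] (q : ℕ) (p : Table X Y A B) : Prop :=
  ∃ (H : Type) (_ : NormedAddCommGroup H) (_ : InnerProductSpace ℂ H) (_ : CompleteSpace H)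
    (π : QProtocol X Y A B q H), ∀ x y a b, (p x y a b : ℂ) = π.prob x y a b

/-! ### Communication complexity -/

/-- The least amount of communication for which `p` can be simulated (`⊤` if there is none). -/
def exactComplexity {X Y A B : Type*} (Sim : ℕ → Table X Y A B → Prop) (p : Table X Y A B) : ℕ∞ :=
  ⨅ (t : ℕ) (_ : Sim t p), (t : ℕ∞)

/-- The least amount of communication for which some non-signaling distribution at statistical
distance at most `ε` from `p` can be simulated. -/
def approxComplexity {X Y A B : Type*} [Fintype A] [Fintype B]
    (Sim : ℕ → Table X Y A B → Prop) (ε : ℝ) (p : Table X Y A B) : ℕ∞ :=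
  ⨅ (p' : Table X Y A B) (_ : NonSignaling p') (_ : tvDist p p' ≤ ε), exactComplexity Sim p'

/-- `R₀^pub(p)` -/
def R0pub {X Y A B : Type*} (p : Table X Y A B) : ℕ∞ :=
  exactComplexity ClassicalSim p

/-- `R_ε^pub(p)` -/
def Rpub {X Y A B : Type*} [Fintype A] [Fintype B] (ε : ℝ) (p : Table X Y A B) : ℕ∞ :=
  approxComplexity ClassicalSim ε p

/-- `Q₀^ent(p)` -/
def Q0ent {X Y A B : Type*} [Fintype A] [Fintype B] (p : Table X Y A B) : ℕ∞ :=
  exactComplexity QuantumSim p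

/-- `Q_ε^ent(p)` -/
def Qent {X Y A B : Type*} [Fintype A] [Fintype B] (ε : ℝ) (p : Table X Y A B) : ℕ∞ :=
  approxComplexity QuantumSim ε p

end

/-! Communication is traded for postselection. A deterministic protocol with `t` bits is imitated
without communication by drawing the transcript from shared randomness; a player who sees that a bit
of his own is wrong outputs `none`. With probability exactly `2 ^ (-t)`, independently of the
inputs, nobody aborts, and the outcomes are then those of the protocol.

A quantum protocol with `q` qubits is handled by postselected teleportation. All that Alice does is
collected into one family of operators (a comb) from the register `β` of Bob's qubits to the
register `α` of hers, and likewise for Bob, so that the final state is a contraction of the two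
families. The Choi-type positive operators of the combs, scaled to be at most `1`, are measured on a
shared maximally entangled state, which performs the contraction with success probability `4 ^
(-q)`. Naimark dilations make these commuting measurements projective.

Either way `p = N R` on the successful outcomes, with `R` local or quantum and `N = 2 ^ t` or `4 ^
q`. Filling the outcome `none` with samples of the marginals of `p` gives a genuine model of weight
`N`. As `p` and `R` are non-signaling, the surplus is a sum of two nonnegative multiples of product
distributions, of total weight `N - 1`. Hence the cost is at most `2 N - 1`
(`affineCost_le_of_postselection`), and taking logarithms gives items 1 and 2.

For correlations, Alice alone succeeds with probability `1 / d ^ 2` and Bob with `1 / d' ^ 2`, where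
`d d' = 2 ^ q`. The vectors `∑ a E_a ψ` and `∑ b F_b ψ` therefore have norms at most `1 / d` and `1
/ d'`, and the correlations are `2 ^ q` times inner products of vectors of norm at most `1`. By
Tsirelson's construction such inner products, and their negatives, are quantum correlations with
uniform marginals, which yields an affine model of weight `2 ^ q`. For the approximate version,
averaging with the joint flip of both outcomes makes the marginals uniform without increasing the
distance to `C`. -/

noncomputable section

/-! ### Matrices of operators as operators on a direct sum -/

/-- The Hilbert space direct sum of copies of `H`, indexed by `n`. -/
abbrev DirectSumSpace (n H : Type*) : Type _ := PiLp 2 (fun _ : n => H)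

section OperatorMatrix

set_option linter.unusedSectionVars false

variable {H : Type*} [NormedAddCommGroup H] [InnerProductSpace ℂ H]
  {l m n : Type*} [Fintype l] [Fintype m] [Fintype n]

/-- The operator between direct sums of copies of `H` given by a matrix of operators on `H`. -/
def opMat (M : Matrix m n (H →L[ℂ] H)) : DirectSumSpace n H →L[ℂ] DirectSumSpace m H :=
  (PiLp.continuousLinearEquiv 2 ℂ (fun _ : m => H)).symm.toContinuousLinearMap ∘L
    (ContinuousLinearMap.pi fun i => ∑ j, M i j ∘L ContinuousLinearMap.proj j) ∘L
    (PiLp.continuousLinearEquiv 2 ℂ (fun _ : n => H)).toContinuousLinearMap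

theorem opMat_apply (M : Matrix m n (H →L[ℂ] H)) (v : DirectSumSpace n H) (i : m) :
    opMat M v i = ∑ j, M i j (v j) := by
  simp [opMat]

theorem opMat_mul (M : Matrix l m (H →L[ℂ] H)) (N : Matrix m n (H →L[ℂ] H)) :
    opMat (M * N) = opMat M ∘L opMat N := by
  ext v i
  simp only [opMat_apply, Matrix.mul_apply, ContinuousLinearMap.comp_apply,
    sum_apply, mul_apply_eq_comp, map_sum]
  rw [Finset.sum_comm]

theorem opMat_add (M N : Matrix m n (H →L[ℂ] H)) : opMat (M + N) = opMat M + opMat N := by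
  ext v i
  simp [opMat_apply, Finset.sum_add_distrib]

theorem opMat_zero : opMat (0 : Matrix m n (H →L[ℂ] H)) = 0 := by
  ext v i
  simp [opMat_apply]

theorem opMat_smul (c : ℂ) (M : Matrix m n (H →L[ℂ] H)) : opMat (c • M) = c • opMat M := by
  ext v i
  simp [opMat_apply, Finset.smul_sum]

theorem opMat_conjTranspose [CompleteSpace H] (M : Matrix m n (H →L[ℂ] H)) :
    opMat M.conjTranspose = ContinuousLinearMap.adjoint (opMat M) := by
  rw [ContinuousLinearMap.eq_adjoint_iff]
  intro v w
  simp only [PiLp.inner_apply, opMat_apply, sum_inner, inner_sum, Matrix.conjTranspose_apply,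
    ContinuousLinearMap.star_eq_adjoint, ContinuousLinearMap.adjoint_inner_left]
  rw [Finset.sum_comm]

variable [DecidableEq n] [CompleteSpace H]

/-- Square matrices of operators form a star algebra of operators on the direct sum. -/
def opMatHom (n H : Type*) [Fintype n] [DecidableEq n] [NormedAddCommGroup H]
    [InnerProductSpace ℂ H] [CompleteSpace H] :
    Matrix n n (H →L[ℂ] H) →⋆ₐ[ℂ] (DirectSumSpace n H →L[ℂ] DirectSumSpace n H) where
  toFun := opMat
  map_one' := by
    ext v i
    rw [opMat_apply, Finset.sum_eq_single i] <;> simp +contextual [eq_comm]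
  map_mul' M N := opMat_mul M N
  map_zero' := opMat_zero
  map_add' := opMat_add
  commutes' c := by
    ext v i
    rw [opMat_apply, Finset.sum_eq_single i] <;>
      simp +contextual [Matrix.algebraMap_matrix_apply, eq_comm, Algebra.algebraMap_eq_smul_one]
  map_star' M := opMat_conjTranspose M

theorem opMatHom_apply (M : Matrix n n (H →L[ℂ] H)) : opMatHom n H M = opMat M := rfl

/-- The diagonal action of an operator on a direct sum of copies. -/
def ampliation (n H : Type*) [Fintype n] [DecidableEq n] [NormedAddCommGroup H]
    [InnerProductSpace ℂ H] [CompleteSpace H] :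
    (H →L[ℂ] H) →⋆ₐ[ℂ] (DirectSumSpace n H →L[ℂ] DirectSumSpace n H) where
  toFun T := opMat (Matrix.diagonal fun _ => T)
  map_one' := by rw [Matrix.diagonal_one]; exact map_one (opMatHom n H)
  map_mul' S T := by rw [← Matrix.diagonal_mul_diagonal]; exact opMat_mul _ _
  map_zero' := by rw [Matrix.diagonal_zero]; exact opMat_zero
  map_add' S T := by rw [← opMat_add, Matrix.diagonal_add]
  commutes' c := by
    rw [← AlgHomClass.commutes (opMatHom n H) c, opMatHom_apply,
      Matrix.algebraMap_eq_diagonal]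
    rfl
  map_star' T := by
    change _ = ContinuousLinearMap.adjoint _
    rw [← opMat_conjTranspose, Matrix.diagonal_conjTranspose]
    rfl

theorem ampliation_apply (T : H →L[ℂ] H) (v : DirectSumSpace n H) (i : n) :
    ampliation n H T v i = T (v i) := by
  change opMat _ v i = _
  rw [opMat_apply, Finset.sum_eq_single i] <;> simp +contextual [eq_comm]

theorem commute_ampliation_opMat {T : H →L[ℂ] H} {M : Matrix n n (H →L[ℂ] H)}
    (h : ∀ i j, Commute T (M i j)) : Commute (ampliation n H T) (opMat M) := by
  ext v i
  simp only [mul_apply_eq_comp, ampliation_apply, opMat_apply, map_sum]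
  refine Finset.sum_congr rfl fun j _ => ?_
  exact congrArg (fun f : H →L[ℂ] H => f (v j)) (h i j)

theorem opMat_single (M : Matrix m n (H →L[ℂ] H)) (j : n) (ψ : H) (i : m) :
    opMat M (PiLp.single 2 j ψ) i = M i j ψ := by
  rw [opMat_apply, Finset.sum_eq_single j] <;> simp +contextual

theorem inner_single_left (j : n) (ψ : H) (v : DirectSumSpace n H) :
    inner ℂ (PiLp.single 2 j ψ : DirectSumSpace n H) v = inner ℂ ψ (v j) := by
  rw [PiLp.inner_apply, Finset.sum_eq_single j] <;> simp +contextual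

theorem norm_single (j : n) (ψ : H) : ‖(PiLp.single 2 j ψ : DirectSumSpace n H)‖ = ‖ψ‖ := by
  simp

end OperatorMatrix


/-! ### Projective measurements -/

theorem IsProjMeas.map {A R S F : Type*} [Fintype A] [Ring R] [StarRing R] [Ring S] [StarRing S]
    [FunLike F R S] [RingHomClass F R S] [StarHomClass F R S] (φ : F) {E : A → R}
    (h : IsProjMeas E) : IsProjMeas fun a => φ (E a) where
  selfAdjoint a := by rw [← map_star, h.selfAdjoint]
  mul_eq a a' := by rw [← map_mul, h.mul_eq]; split_ifs <;> simp
  sum_eq_one := by rw [← map_sum, h.sum_eq_one, map_one]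

theorem IsProjMeas.conj {A R : Type*} [Fintype A] [Ring R] [StarRing R] {E : A → R}
    (h : IsProjMeas E) {U : R} (hU : U ∈ unitary R) : IsProjMeas fun a => star U * E a * U where
  selfAdjoint a := by simp [h.selfAdjoint, mul_assoc]
  mul_eq a a' := by
    have : star U * E a * U * (star U * E a' * U) = star U * (E a * E a') * U := by
      calc _ = star U * E a * (U * star U) * E a' * U := by simp only [mul_assoc]
        _ = _ := by rw [Unitary.mul_star_self_of_mem hU]; simp only [mul_assoc, mul_one]
    rw [this, h.mul_eq]
    split_ifs <;> simp
  sum_eq_one := by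
    rw [← Finset.sum_mul, ← Finset.mul_sum, h.sum_eq_one, mul_one,
      Unitary.star_mul_self_of_mem hU]

open Classical in
theorem isProjMeas_diagonal {A R n : Type*} [Fintype A] [Ring R] [StarRing R] [Fintype n]
    [DecidableEq n] (f : n → A) : IsProjMeas fun a =>
      (Matrix.diagonal fun i => if f i = a then 1 else 0 : Matrix n n R) where
  selfAdjoint a := by
    rw [Matrix.star_eq_conjTranspose, Matrix.diagonal_conjTranspose]
    congr 1
    ext i
    simp only [Pi.star_apply]
    split_ifs <;> simp
  mul_eq a a' := by
    rw [Matrix.diagonal_mul_diagonal]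
    split_ifs with h
    · subst h
      congr 1
      ext i
      split_ifs <;> simp
    · rw [← Matrix.diagonal_zero]
      congr 1
      ext i
      grind
  sum_eq_one := by
    ext i j
    rw [Matrix.sum_apply]
    rcases eq_or_ne i j with rfl | h
    · simp
    · simp [h]

/-! ### Commuting generalized measurements -/

/-- The unitary that extends the isometry with components `k a`. -/
def dilationUnitary {n R : Type*} [DecidableEq n] [Ring R] (k : n → R) :
    Matrix (Option n) (Option n) R
  | some a, some a' => (if a = a' then 1 else 0) - k a * k a'
  | some a, none => k a
  | none, some a => -k a
  | none, none => 0

/-- With `k` as a column, `hs` says that `k` is an isometry, so `k k*` is a projection and the block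
matrix with rows `(1 - k k*, k)` and `(-k*, 0)` is unitary. -/
theorem dilationUnitary_mem {n R : Type*} [Fintype n] [DecidableEq n] [Ring R] [StarRing R]
    {k : n → R} (hk : ∀ a, star (k a) = k a) (hs : ∑ a, k a * k a = 1) :
    dilationUnitary k ∈ unitary (Matrix (Option n) (Option n) R) := by
  have key : ∀ a b : n, ∑ c, k a * k c * (k c * k b) = k a * k b := fun a b => by
    calc ∑ c, k a * k c * (k c * k b) = k a * (∑ c, k c * k c) * k b := by
          rw [Finset.mul_sum, Finset.sum_mul]; simp only [mul_assoc]
      _ = _ := by rw [hs, mul_one]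
  have key1 : ∀ a : n, ∑ c, k a * k c * k c = k a := fun a => by
    simp only [mul_assoc]; rw [← Finset.mul_sum, hs, mul_one]
  have key2 : ∀ a : n, ∑ c, k c * (k c * k a) = k a := fun a => by
    simp only [← mul_assoc]; rw [← Finset.sum_mul, hs, one_mul]
  rw [Unitary.mem_iff]
  constructor <;> ext i j <;> rcases i with _ | i <;> rcases j with _ | j <;>
    simp [Matrix.mul_apply, Matrix.star_apply, dilationUnitary, Fintype.sum_option, hk, hs,
      sub_mul, mul_sub, key, key1, key2, apply_ite star, Matrix.one_apply, Finset.sum_sub_distrib,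
      Finset.sum_add_distrib, eq_comm]


open Classical in
/-- The projective measurement obtained from the isometry with components `k c`, where the
component `c` is read as the outcome `f (some c)`. -/
def dilationMeas {A n R : Type*} [Fintype n] [DecidableEq n] [Ring R] [StarRing R]
    (f : Option n → A) (k : n → R) (a : A) : Matrix (Option n) (Option n) R :=
  star (dilationUnitary k) * (Matrix.diagonal fun i => if f i = a then 1 else 0) *
    dilationUnitary k

-- Naimark: the column `none` of the unitary is `(k, 0)`, so the corner recovers the squares `k c *
-- k c`. The value `f none` meets only the entry `0` and plays no role.
open Classical in
theorem dilationMeas_none_none {A n R : Type*} [Fintype n] [DecidableEq n] [Ring R] [StarRing R]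
    (f : Option n → A) {k : n → R} (hk : ∀ c, star (k c) = k c) (a : A) :
    dilationMeas f k a none none = ∑ c, if f (some c) = a then k c * k c else 0 := by
  simp [dilationMeas, Matrix.mul_apply, Matrix.diagonal_apply, Fintype.sum_option,
    dilationUnitary, Matrix.star_apply, hk]

theorem isProjMeas_dilationMeas {A n R : Type*} [Fintype A] [Fintype n] [DecidableEq n] [Ring R]
    [StarRing R] (f : Option n → A) {k : n → R} (hk : ∀ c, star (k c) = k c)
    (hs : ∑ c, k c * k c = 1) : IsProjMeas (dilationMeas f k) :=
  (isProjMeas_diagonal f).conj (dilationUnitary_mem hk hs)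

/-- All entries are polynomials in the `k c`. This keeps the other player's operators commuting with
the dilated ones. -/
theorem commute_dilationMeas {A n R : Type*} [Fintype n] [DecidableEq n] [Ring R] [StarRing R]
    (f : Option n → A) {k : n → R} (hk : ∀ c, star (k c) = k c) (a : A) {T : R}
    (hT : ∀ c, Commute T (k c)) (i j : Option n) : Commute T (dilationMeas f k a i j) := by
  have hU : ∀ i j, Commute T (dilationUnitary k i j) := by
    rintro (_ | i) (_ | j)
    · exact Commute.zero_right T
    · exact (hT j).neg_right
    · exact hT i
    · refine Commute.sub_right ?_ ((hT i).mul_right (hT j))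
      split_ifs
      · exact Commute.one_right T
      · exact Commute.zero_right T
  have hU' : ∀ i j, Commute T (star (dilationUnitary k) i j) := by
    rintro (_ | i) (_ | j)
    · simp [Matrix.star_apply, dilationUnitary]
    · simpa [Matrix.star_apply, dilationUnitary, hk] using hT j
    · simpa [Matrix.star_apply, dilationUnitary, hk] using (hT i).neg_right
    · simp only [Matrix.star_apply, dilationUnitary, star_sub, star_mul, hk]
      refine Commute.sub_right ?_ ((hT i).mul_right (hT j))
      split_ifs
      · simp
      · simp
  rw [dilationMeas, Matrix.mul_apply]
  refine Commute.sum_right _ _ _ fun u _ => Commute.mul_right ?_ (hU u j)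
  rw [Matrix.mul_apply]
  refine Commute.sum_right _ _ _ fun v _ => (hU' i v).mul_right ?_
  rw [Matrix.diagonal_apply]
  split_ifs
  · exact Commute.one_right T
  · exact Commute.zero_right T
  · exact Commute.zero_right T

/-- Naimark dilation with `k = √E`. The square root commutes with everything that commutes with `E`,
so the ampliated commutant of the family survives the dilation. -/
theorem exists_proj_dilation {H X A : Type*} [NormedAddCommGroup H] [InnerProductSpace ℂ H]
    [CompleteSpace H] [Fintype A] [Nonempty A] {E : X → A → H →L[ℂ] H}
    (h0 : ∀ x a, 0 ≤ E x a) (h1 : ∀ x, ∑ a, E x a = 1) :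
    ∃ (n : Type) (_ : Fintype n) (_ : DecidableEq n) (i : n)
      (P : X → A → DirectSumSpace n H →L[ℂ] DirectSumSpace n H),
      (∀ x, IsProjMeas (P x)) ∧
      (∀ T, (∀ x a, Commute (E x a) T) → ∀ x a, Commute (P x a) (ampliation n H T)) ∧
      ∀ x a T ψ, inner ℂ (PiLp.single 2 i ψ : DirectSumSpace n H)
        ((P x a * ampliation n H T) (PiLp.single 2 i ψ)) = inner ℂ ψ ((E x a * T) ψ) := by
  classical
  -- `Fin m` replaces `A` so that the dilated space stays in `Type`, as `quantumSet` requires.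
  obtain ⟨m, e⟩ : ∃ m : ℕ, Nonempty (Fin m ≃ A) := ⟨_, ⟨(Fintype.equivFin A).symm⟩⟩
  obtain ⟨e⟩ := e
  obtain ⟨f, hf⟩ : ∃ f : Option (Fin m) → A, ∀ c, f (some c) = e c :=
    ⟨fun i => i.elim (Classical.arbitrary A) e, fun _ => rfl⟩
  obtain ⟨k, hk, hkk, hkT⟩ : ∃ k : X → Fin m → H →L[ℂ] H, (∀ x c, star (k x c) = k x c) ∧
      (∀ x c, k x c * k x c = E x (e c)) ∧
      ∀ T x c, Commute (E x (e c)) T → Commute T (k x c) :=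
    ⟨fun x c => CFC.sqrt (E x (e c)),
      fun x c => (IsSelfAdjoint.of_nonneg (CFC.sqrt_nonneg (E x (e c)))).star_eq,
      fun x c => CFC.sqrt_mul_sqrt_self _ (h0 x _),
      fun T x c h => (Commute.cfcₙ_nnreal h NNReal.sqrt).symm⟩
  have hs : ∀ x, ∑ c, k x c * k x c = 1 := fun x => by
    simp only [hkk]
    rw [← h1 x]
    exact Equiv.sum_comp e (E x)
  have hM : ∀ x, IsProjMeas (dilationMeas f (k x)) := fun x =>
    isProjMeas_dilationMeas f (hk x) (hs x)
  have hM0 : ∀ x a, dilationMeas f (k x) a none none = E x a := fun x a => by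
    rw [dilationMeas_none_none f (hk x)]
    simp only [hkk, hf]
    rw [Equiv.sum_comp e fun a' => if a' = a then E x a' else 0]
    simp
  refine ⟨Option (Fin m), inferInstance, inferInstance, none,
    fun x a => opMat (dilationMeas f (k x) a), fun x => (hM x).map (opMatHom (Option (Fin m)) H),
    ?_, ?_⟩
  · intro T hT x a
    exact (commute_ampliation_opMat
      (commute_dilationMeas f (hk x) a fun c => hkT T x c (hT x (e c)))).symm
  · intro x a T ψ
    have : ampliation (Option (Fin m)) H T (PiLp.single 2 none ψ) =
        PiLp.single 2 none (T ψ) := by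
      ext i
      rw [ampliation_apply]
      rcases i with _ | i <;> simp
    rw [inner_single_left, mul_apply_eq_comp, mul_apply_eq_comp, this, opMat_single, hM0]

/-- Commuting generalized measurements give quantum distributions. -/
theorem mem_quantumSet_of_povm {H : Type} {X Y A B : Type*} [NormedAddCommGroup H]
    [InnerProductSpace ℂ H] [CompleteSpace H] [Fintype A] [Fintype B] [Nonempty A] [Nonempty B]
    {ψ : H} (hψ : ‖ψ‖ = 1) {E : X → A → H →L[ℂ] H} {F : Y → B → H →L[ℂ] H}
    (hE : ∀ x a, 0 ≤ E x a) (hE1 : ∀ x, ∑ a, E x a = 1)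
    (hF : ∀ y b, 0 ≤ F y b) (hF1 : ∀ y, ∑ b, F y b = 1)
    (hcomm : ∀ x y a b, Commute (E x a) (F y b)) {p : Table X Y A B}
    (hp : ∀ x y a b, (p x y a b : ℂ) = inner ℂ ψ ((E x a * F y b) ψ)) :
    p ∈ quantumSet X Y A B := by
  obtain ⟨n, _, _, i, P, hP, hPc, hPi⟩ := exists_proj_dilation hE hE1
  have hF' : ∀ y b, 0 ≤ ampliation n H (F y b) := fun y b => map_nonneg _ (hF y b)
  have hF1' : ∀ y, ∑ b, ampliation n H (F y b) = 1 := fun y => by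
    rw [← map_sum, hF1, map_one]
  -- The players are dilated one after the other: Bob's ampliated operators still commute with the
  -- projections `P`, and so are dilated next, with `P` ampliated in turn.
  have hc : ∀ x y a b, Commute (P x a) (ampliation n H (F y b)) := fun x y a b =>
    hPc _ (fun x' a' => hcomm x' y a' b) x a
  obtain ⟨m, _, _, j, Q, hQ, hQc, hQi⟩ := exists_proj_dilation hF' hF1'
  refine ⟨DirectSumSpace m (DirectSumSpace n H), inferInstance, inferInstance, inferInstance,
    PiLp.single 2 j (PiLp.single 2 i ψ), fun x a => ampliation m (DirectSumSpace n H) (P x a), Q, ?_,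
    fun x => (hP x).map (ampliation m (DirectSumSpace n H)), hQ, ?_, ?_⟩
  · rw [norm_single, norm_single, hψ]
  · intro x y a b
    exact (hQc _ (fun y' b' => (hc x y' a b').symm) y b).symm
  · intro x y a b
    have h := (hQc _ (fun y' b' => (hc x y' a b').symm) y b).symm
    rw [h.eq, hQi, ← (hc x y a b).eq, hPi, hp]

end

noncomputable section

/-! ### Affine models -/

section AffineCost

variable {X Y A B : Type*}

theorem affineCost_nonneg (S : Set (Table X Y A B)) (p : Table X Y A B) : 0 ≤ affineCost S p := by
  refine Real.sInf_nonneg ?_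
  rintro s ⟨n, q, P, -, -, rfl⟩
  exact Finset.sum_nonneg fun i _ => abs_nonneg _

theorem affineCost_le {S : Set (Table X Y A B)} {p : Table X Y A B} {n : ℕ} (q : Fin n → ℝ)
    (P : Fin n → Table X Y A B) (hP : ∀ i, P i ∈ S) (hp : p = ∑ i, q i • P i) :
    affineCost S p ≤ ∑ i, |q i| := by
  refine csInf_le ⟨0, ?_⟩ ⟨n, q, P, hP, hp, rfl⟩
  rintro s ⟨n, q, P, -, -, rfl⟩
  exact Finset.sum_nonneg fun i _ => abs_nonneg _

theorem affineCostApprox_nonneg [Fintype A] [Fintype B] (S : Set (Table X Y A B)) (ε : ℝ)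
    (p : Table X Y A B) : 0 ≤ affineCostApprox S ε p := by
  refine Real.sInf_nonneg ?_
  rintro s ⟨p', -, -, rfl⟩
  exact affineCost_nonneg S p'

theorem affineCostApprox_le [Fintype A] [Fintype B] (S : Set (Table X Y A B)) {ε : ℝ}
    {p p' : Table X Y A B} (h : NonSignaling p') (hε : tvDist p p' ≤ ε) :
    affineCostApprox S ε p ≤ affineCost S p' := by
  refine csInf_le ⟨0, ?_⟩ ⟨p', h, hε, rfl⟩
  rintro s ⟨p', -, -, rfl⟩
  exact affineCost_nonneg S p'

/-- A family of probability distributions on a finite set. -/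
structure IsDist {X A : Type*} [Fintype A] (s : X → A → ℝ) : Prop where
  nonneg : ∀ x a, 0 ≤ s x a
  sum_eq_one : ∀ x, ∑ a, s x a = 1

/-- The distribution of two independent local outcomes. -/
def prodTable (s : X → A → ℝ) (t : Y → B → ℝ) : Table X Y A B := fun x y a b => s x a * t y b

/-- The table obtained by replacing the outcome `none` of Alice by a sample of `s`, and that of
Bob by an independent sample of `t`. -/
def fillTable (s : X → A → ℝ) (t : Y → B → ℝ) (R : Table X Y (Option A) (Option B)) :
    Table X Y A B := fun x y a b =>
  R x y (some a) (some b) + R x y (some a) none * t y b + s x a * R x y none (some b) +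
    R x y none none * (s x a * t y b)

/-- Normalization of a nonnegative family with constant total `c`. If `c = 0` the family vanishes,
and `u` serves as a default distribution. -/
theorem exists_isDist_smul [Fintype A] {w u : X → A → ℝ} {c : ℝ} (hu : IsDist u)
    (hw : ∀ x a, 0 ≤ w x a) (hc : ∀ x, ∑ a, w x a = c) (h0 : 0 ≤ c) :
    ∃ s : X → A → ℝ, IsDist s ∧ ∀ x a, c * s x a = w x a := by
  rcases h0.eq_or_lt with rfl | hpos
  · refine ⟨u, hu, fun x a => ?_⟩
    rw [zero_mul]
    exact ((Finset.sum_eq_zero_iff_of_nonneg fun a _ => hw x a).1 (hc x) a (Finset.mem_univ a)).symm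
  · refine ⟨fun x a => w x a / c, ⟨fun x a => div_nonneg (hw x a) h0, fun x => ?_⟩, fun x a => ?_⟩
    · rw [← Finset.sum_div, hc, div_self hpos.ne']
    · exact mul_div_cancel₀ _ hpos.ne'

/-- If `p` is obtained, up to the factor `1 / N`, by discarding the outcome `none` in a
non-signaling distribution, then `p` has an affine model of total weight `2 N - 1`. -/
theorem affineCost_le_of_postselection [Finite X] [Nonempty X] [Nonempty Y] [Fintype A] [Fintype B]
    {S : Set (Table X Y A B)} {p : Table X Y A B} (hp : NonSignaling p)
    {R : Table X Y (Option A) (Option B)} (hR : NonSignaling R) {N : ℝ} (hN : 1 ≤ N)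
    (hRp : ∀ x y a b, N * R x y (some a) (some b) = p x y a b)
    (hprod : ∀ s t, IsDist s → IsDist t → prodTable s t ∈ S)
    (hfill : ∀ s t, IsDist s → IsDist t → fillTable s t R ∈ S) :
    affineCost S p ≤ 2 * N - 1 := by
  obtain ⟨x₀⟩ := ‹Nonempty X›
  obtain ⟨y₀⟩ := ‹Nonempty Y›
  have hN0 : 0 ≤ N := zero_le_one.trans hN
  obtain ⟨u, hu⟩ : ∃ u : X → A → ℝ, ∀ x y a, ∑ b, p x y a b = u x a :=
    ⟨fun x a => ∑ b, p x y₀ a b, fun x y a => hp.alice a x y y₀⟩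
  obtain ⟨v, hv⟩ : ∃ v : Y → B → ℝ, ∀ x y b, ∑ a, p x y a b = v y b :=
    ⟨fun y b => ∑ a, p x₀ y a b, fun x y b => hp.bob b x x₀ y⟩
  -- `F` and `G` are `N` times the marginals of `R` on the proper outcomes of one player.
  -- No-signaling makes each depend on one input only, which is what allows the surplus to be
  -- cancelled by product distributions.
  obtain ⟨F, hF⟩ : ∃ F : X → A → ℝ, ∀ x y a, N * ∑ b, R x y (some a) b = F x a :=
    ⟨fun x a => N * ∑ b, R x y₀ (some a) b, fun x y a => by rw [hR.alice (some a) x y y₀]⟩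
  obtain ⟨G, hG⟩ : ∃ G : Y → B → ℝ, ∀ x y b, N * ∑ a, R x y a (some b) = G y b :=
    ⟨fun y b => N * ∑ a, R x₀ y a (some b), fun x y b => by rw [hR.bob (some b) x x₀ y]⟩
  have hRA : ∀ x y a, N * R x y (some a) none = F x a - u x a := fun x y a => by
    rw [← hF x y, ← hu x y, Fintype.sum_option, mul_add, Finset.mul_sum]
    simp [hRp]
  have hRB : ∀ x y b, N * R x y none (some b) = G y b - v y b := fun x y b => by
    rw [← hG x y, ← hv x y, Fintype.sum_option, mul_add, Finset.mul_sum]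
    simp [hRp]
  have hud : IsDist u := ⟨fun x a => by
    rw [← hu x y₀]; exact Finset.sum_nonneg fun b _ => hp.nonneg _ _ _ _, fun x => by
    rw [← hp.sum_eq_one x y₀]; exact Finset.sum_congr rfl fun a _ => (hu x y₀ a).symm⟩
  have hvd : IsDist v := ⟨fun y b => by
    rw [← hv x₀]; exact Finset.sum_nonneg fun a _ => hp.nonneg _ _ _ _, fun y => by
    rw [← hp.sum_eq_one x₀ y, Finset.sum_comm]
    exact Finset.sum_congr rfl fun b _ => (hv x₀ y b).symm⟩
  have hRN : ∀ x y, N * R x y none none = N - ∑ a, F x a - ∑ b, G y b + 1 := fun x y => by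
    have h := hR.sum_eq_one x y
    simp only [Fintype.sum_option] at h
    have h2 : N * (R x y none none) + ∑ b, N * R x y none (some b) + (∑ a, N * R x y (some a) none
        + ∑ a, ∑ b, N * R x y (some a) (some b)) = N := by
      simp only [← Finset.mul_sum]
      rw [Finset.sum_add_distrib] at h
      linear_combination N * h
    simp only [hRA, hRB, hRp, Finset.sum_sub_distrib, hp.sum_eq_one, hud.sum_eq_one,
      hvd.sum_eq_one] at h2
    linarith
  have hFu : ∀ x a, u x a ≤ F x a := fun x a => by
    have := mul_nonneg hN0 (hR.nonneg x y₀ (some a) none)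
    rw [hRA] at this; linarith
  have hGv : ∀ y b, v y b ≤ G y b := fun y b => by
    have := mul_nonneg hN0 (hR.nonneg x₀ y none (some b))
    rw [hRB] at this; linarith
  have hnn : ∀ x y, ∑ a, F x a + ∑ b, G y b ≤ N + 1 := fun x y => by
    have := mul_nonneg hN0 (hR.nonneg x y none none)
    rw [hRN] at this; linarith
  have hGs : ∀ y, 1 ≤ ∑ b, G y b := fun y => by
    rw [← hvd.sum_eq_one y]; exact Finset.sum_le_sum fun b _ => hGv y b
  have hFs : ∀ x, 1 ≤ ∑ a, F x a := fun x => by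
    rw [← hud.sum_eq_one x]; exact Finset.sum_le_sum fun b _ => hFu x b
  have : Nonempty X := ⟨x₀⟩
  -- The surplus of `N` times the filled table over `p` is `F v + u G + (N - 1 - ∑ F - ∑ G) u v`.
  -- Since `c + d = N - 1`, it splits as `(F + (c - ∑ F) u) v + u (G + (d - ∑ G) v)`. Nonnegativity
  -- requires `∑ F ≤ c + 1` and `∑ G ≤ d + 1`: the maximal value of `∑ F` gives the first, and `hnn`
  -- at the maximizer `x₁` gives the second.
  obtain ⟨x₁, hx₁⟩ := Finite.exists_max fun x => ∑ a, F x a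
  set c : ℝ := ∑ a, F x₁ a - 1 with hc
  set d : ℝ := N - ∑ a, F x₁ a with hd
  have hc0 : 0 ≤ c := by have := hFs x₁; linarith
  have hd0 : 0 ≤ d := by have := hnn x₁ y₀; have := hGs y₀; linarith
  obtain ⟨s, hs, hsw⟩ := exists_isDist_smul (w := fun x a => F x a + (c - ∑ a, F x a) * u x a)
    (c := c) hud (fun x a => by
      have h1 := mul_nonneg (show 0 ≤ c + 1 - ∑ a, F x a by have := hx₁ x; linarith)
        (hud.nonneg x a)
      have h2 := hFu x a
      linarith) (fun x => by
      rw [Finset.sum_add_distrib, ← Finset.mul_sum, hud.sum_eq_one]; ring) hc0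
  obtain ⟨t, ht, htw⟩ := exists_isDist_smul (w := fun y b => G y b + (d - ∑ b, G y b) * v y b)
    (c := d) hvd (fun y b => by
      have h1 := mul_nonneg (show 0 ≤ d + 1 - ∑ b, G y b by have := hnn x₁ y; linarith)
        (hvd.nonneg y b)
      have h2 := hGv y b
      linarith) (fun x => by
      rw [Finset.sum_add_distrib, ← Finset.mul_sum, hvd.sum_eq_one]; ring) hd0
  have key := affineCost_le (S := S) (p := p) ![N, -c, -d]
    ![fillTable u v R, prodTable s v, prodTable u t] (by
      intro i
      fin_cases i
      exacts [hfill _ _ hud hvd, hprod _ _ hs hvd, hprod _ _ hud ht]) (by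
      ext x y a b
      simp only [Fin.sum_univ_three, Matrix.cons_val_zero, Matrix.cons_val_one, Matrix.cons_val,
        Pi.add_apply, Pi.smul_apply, smul_eq_mul, fillTable, prodTable]
      linear_combination v y b * hsw x a + u x a * htw y b - hRp x y a b - v y b * hRA x y a
        - u x a * hRB x y b - u x a * v y b * hRN x y)
  refine key.trans (le_of_eq ?_)
  simp only [Fin.sum_univ_three, Matrix.cons_val_zero, Matrix.cons_val_one, Matrix.cons_val,
    abs_neg, abs_of_nonneg hc0, abs_of_nonneg hd0, abs_of_nonneg hN0]
  rw [hc, hd]; ring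

end AffineCost

/-! ### Local distributions -/

section Local

variable {X Y A B : Type*}

theorem convex_nonSignaling [Fintype A] [Fintype B] :
    Convex ℝ {p : Table X Y A B | NonSignaling p} := by
  intro p hp p' hp' s t hs ht hst
  refine ⟨fun x y a b => ?_, fun x y => ?_, fun a x y y' => ?_, fun b x x' y => ?_⟩
  · have := hp.nonneg x y a b; have := hp'.nonneg x y a b
    simp only [Pi.add_apply, Pi.smul_apply, smul_eq_mul]; positivity
  · simp only [Pi.add_apply, Pi.smul_apply, smul_eq_mul, Finset.sum_add_distrib,
      ← Finset.mul_sum, hp.sum_eq_one, hp'.sum_eq_one, mul_one, hst]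
  · simp only [Pi.add_apply, Pi.smul_apply, smul_eq_mul, Finset.sum_add_distrib,
      ← Finset.mul_sum, hp.alice a x y y', hp'.alice a x y y']
  · simp only [Pi.add_apply, Pi.smul_apply, smul_eq_mul, Finset.sum_add_distrib,
      ← Finset.mul_sum, hp.bob b x x' y, hp'.bob b x x' y]

theorem nonSignaling_prodTable [Fintype A] [Fintype B] {s : X → A → ℝ} {t : Y → B → ℝ}
    (hs : IsDist s) (ht : IsDist t) : NonSignaling (prodTable s t) := by
  refine ⟨fun x y a b => mul_nonneg (hs.nonneg x a) (ht.nonneg y b), fun x y => ?_,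
    fun a x y y' => ?_, fun b x x' y => ?_⟩ <;>
  simp [prodTable, ← Finset.mul_sum, ← Finset.sum_mul, hs.sum_eq_one, ht.sum_eq_one]

open Classical in
/-- The family of point masses given by an output function. -/
def detDist (l : X → A) : X → A → ℝ := fun x a => if a = l x then 1 else 0

theorem isDist_detDist [Fintype A] (l : X → A) : IsDist (detDist l) := by
  classical
  refine ⟨fun x a => ?_, fun x => ?_⟩
  · simp only [detDist]; positivity
  · simp [detDist]

theorem localDet_eq_prodTable (l : (X → A) × (Y → B)) :
    localDet l = prodTable (detDist l.1) (detDist l.2) := rfl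

theorem nonSignaling_of_mem_localSet [Fintype A] [Fintype B] {p : Table X Y A B}
    (hp : p ∈ localSet X Y A B) : NonSignaling p :=
  convexHull_min (by
    rintro _ ⟨l, rfl⟩
    exact nonSignaling_prodTable (isDist_detDist l.1) (isDist_detDist l.2)) convex_nonSignaling hp

theorem IsDist.sum_prod_eq_one [Fintype X] [DecidableEq X] [Fintype A] {s : X → A → ℝ}
    (hs : IsDist s) : ∑ l : X → A, ∏ z, s z (l z) = 1 := by
  rw [← Fintype.piFinset_univ, ← Finset.prod_univ_sum]
  simp [hs.sum_eq_one]

/-- When an output function is drawn with independent values at all inputs, its value at `x` has law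
`s x`. -/
theorem IsDist.sum_prod_mul_detDist [Fintype X] [DecidableEq X] [Fintype A] {s : X → A → ℝ}
    (hs : IsDist s) (x : X) (a : A) : ∑ l : X → A, (∏ z, s z (l z)) * detDist l x a = s x a := by
  classical
  have h : ∀ l : X → A, (∏ z, s z (l z)) * detDist l x a =
      ∏ z, s z (l z) * (if z = x then (if a = l z then 1 else 0) else 1) := fun l => by
    rw [Finset.prod_mul_distrib]
    simp [detDist]
  simp only [h]
  rw [← Fintype.piFinset_univ, ← Finset.prod_univ_sum
    (f := fun z a' => s z a' * (if z = x then (if a = a' then 1 else 0) else 1)),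
    Finset.prod_eq_single x]
  · simp
  · intro z _ hz
    simp [hz, hs.sum_eq_one]
  · simp

/-- Private randomness is moved to the start: each player draws a whole output function with product
weights. -/
theorem prodTable_mem_localSet [Fintype X] [Fintype Y] [Fintype A] [Fintype B]
    {s : X → A → ℝ} {t : Y → B → ℝ} (hs : IsDist s) (ht : IsDist t) :
    prodTable s t ∈ localSet X Y A B := by
  classical
  have h : prodTable s t = ∑ l : (X → A) × (Y → B),
      ((∏ z, s z (l.1 z)) * ∏ z, t z (l.2 z)) • localDet l := by
    ext x y a b
    simp only [Finset.sum_apply, Pi.smul_apply, smul_eq_mul, localDet_eq_prodTable, prodTable,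
      Fintype.sum_prod_type]
    rw [← hs.sum_prod_mul_detDist x a, ← ht.sum_prod_mul_detDist y b, Finset.sum_mul_sum]
    refine Finset.sum_congr rfl fun l _ => Finset.sum_congr rfl fun l' _ => ?_
    ring
  rw [h]
  refine (convex_convexHull ℝ _).sum_mem (fun l _ => ?_) ?_ fun l _ =>
    subset_convexHull ℝ _ ⟨l, rfl⟩
  · exact mul_nonneg (Finset.prod_nonneg fun z _ => hs.nonneg _ _)
      (Finset.prod_nonneg fun z _ => ht.nonneg _ _)
  · rw [Fintype.sum_prod_type]
    simp only [← Finset.mul_sum, ht.sum_prod_eq_one, mul_one, hs.sum_prod_eq_one]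

theorem map_mem_localSet {X' Y' A' B' : Type*} (f : Table X Y A B →ₗ[ℝ] Table X' Y' A' B')
    (hf : ∀ l, f (localDet l) ∈ localSet X' Y' A' B') {R : Table X Y A B}
    (hR : R ∈ localSet X Y A B) : f R ∈ localSet X' Y' A' B' :=
  convexHull_min (t := f ⁻¹' localSet X' Y' A' B') (by rintro _ ⟨l, rfl⟩; exact hf l)
    ((convex_convexHull ℝ _).linear_preimage f) hR

theorem IsDist.fill [Fintype A] {s : X → A → ℝ} (hs : IsDist s) (l : X → Option A) :
    IsDist fun x a => detDist l x (some a) + detDist l x none * s x a := by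
  refine ⟨fun x a => ?_, fun x => ?_⟩
  · exact add_nonneg ((isDist_detDist l).nonneg _ _)
      (mul_nonneg ((isDist_detDist l).nonneg _ _) (hs.nonneg _ _))
  · rw [Finset.sum_add_distrib, ← Finset.mul_sum, hs.sum_eq_one, mul_one, add_comm,
      ← Fintype.sum_option (f := detDist l x), (isDist_detDist l).sum_eq_one]

/-- Filling is linear in the table, and it turns a deterministic table into a product table. -/
theorem fillTable_mem_localSet [Fintype X] [Fintype Y] [Fintype A] [Fintype B]
    {s : X → A → ℝ} {t : Y → B → ℝ} (hs : IsDist s) (ht : IsDist t)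
    {R : Table X Y (Option A) (Option B)} (hR : R ∈ localSet X Y (Option A) (Option B)) :
    fillTable s t R ∈ localSet X Y A B := by
  let f : Table X Y (Option A) (Option B) →ₗ[ℝ] Table X Y A B :=
    { toFun := fillTable s t
      map_add' := fun R R' => by
        ext x y a b; simp only [fillTable, Pi.add_apply]; ring
      map_smul' := fun c R => by
        ext x y a b; simp only [fillTable, Pi.smul_apply, smul_eq_mul, RingHom.id_apply]; ring }
  refine map_mem_localSet f (fun l => ?_) hR
  have : f (localDet l) = prodTable (fun x a => detDist l.1 x (some a) + detDist l.1 x none * s x a)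
      (fun y b => detDist l.2 y (some b) + detDist l.2 y none * t y b) := by
    ext x y a b
    simp only [f, LinearMap.coe_mk, AddHom.coe_mk, fillTable, localDet_eq_prodTable, prodTable]
    ring
  rw [this]
  exact prodTable_mem_localSet (hs.fill l.1) (ht.fill l.2)

/-- Deterministic local processing of the outcomes. -/
def mapOutcomes [Fintype A] [Fintype B] [DecidableEq A] [DecidableEq B] (κ : X → A → A)
    (η : Y → B → B) : Table X Y A B →ₗ[ℝ] Table X Y A B where
  toFun R x y a b := ∑ a', ∑ b', if κ x a' = a ∧ η y b' = b then R x y a' b' else 0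
  map_add' R R' := by
    ext x y a b
    simp only [Pi.add_apply, ← Finset.sum_add_distrib]
    refine Finset.sum_congr rfl fun _ _ => Finset.sum_congr rfl fun _ _ => ?_
    split_ifs <;> simp
  map_smul' c R := by
    ext x y a b
    simp only [Pi.smul_apply, smul_eq_mul, Finset.mul_sum, RingHom.id_apply, mul_ite, mul_zero]

theorem mapOutcomes_mem_localSet [Fintype A] [Fintype B] [DecidableEq A] [DecidableEq B]
    (κ : X → A → A) (η : Y → B → B) {R : Table X Y A B} (hR : R ∈ localSet X Y A B) :
    mapOutcomes κ η R ∈ localSet X Y A B := by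
  refine map_mem_localSet _ (fun l => subset_convexHull ℝ _
    ⟨(fun x => κ x (l.1 x), fun y => η y (l.2 y)), ?_⟩) hR
  ext x y a b
  simp only [mapOutcomes, LinearMap.coe_mk, AddHom.coe_mk, localDet]
  rw [Finset.sum_eq_single (l.1 x), Finset.sum_eq_single (l.2 y)]
  · grind
  · intro b' _ h; simp [h]
  · simp
  · intro a' _ h; simp [h]
  · simp

end Local

/-! ### Classical protocols -/

section Classical

variable {X Y A B : Type*}

open Classical in
/-- A deterministic protocol with `t` bits is simulated, with success probability `2 ^ (-t)`, by
guessing the transcript. -/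
theorem CProtocol.exists_postselection [Fintype A] [Fintype B] (P : CProtocol X Y A B) {t : ℕ}
    (ht : P.cost ≤ t) : ∃ R ∈ localSet X Y (Option A) (Option B), ∀ x y a b,
      R x y (some a) (some b) = (1 / 2) ^ t * if P.run x y = (a, b) then 1 else 0 := by
  induction P generalizing t with
  | output outA outB =>
    -- A leaf may lie at depth less than `t`. To make the success probability exactly `2 ^ (-t)`,
    -- the players abort with the remaining probability.
    have h1 : (1 / 2 : ℝ) ^ t ≤ 1 := pow_le_one₀ (by norm_num) (by norm_num)
    refine ⟨(1 / 2 : ℝ) ^ t • localDet (fun x => some (outA x), fun y => some (outB y)) +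
      (1 - (1 / 2 : ℝ) ^ t) • localDet (fun _ => none, fun _ => none),
      convex_convexHull ℝ _ (subset_convexHull ℝ _ (Set.mem_range_self _))
        (subset_convexHull ℝ _ (Set.mem_range_self _))
        (by positivity) (by linarith) (by ring), fun x y a b => ?_⟩
    simp only [localDet, CProtocol.run, Pi.add_apply, Pi.smul_apply, smul_eq_mul, Option.some.injEq,
      Prod.mk.injEq, reduceCtorEq, if_false, mul_zero, add_zero]
    grind
  | aliceSends bit next ih =>
    obtain ⟨t, rfl⟩ : ∃ k, t = k + 1 := ⟨t - 1, by simp only [CProtocol.cost] at ht; omega⟩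
    have hc : ∀ c, (next c).cost ≤ t := by
      simp only [CProtocol.cost] at ht
      rintro (_ | _) <;> omega
    choose R hR hRv using fun c => ih c (hc c)
    -- A shared coin `c` guesses the bit, both players continue with `next c`, and only the sender
    -- checks the guess. This halves the success probability.
    let κ : Bool → X → Option A → Option A := fun c x a => if bit x = c then a else none
    refine ⟨(1 / 2 : ℝ) • mapOutcomes (κ false) (fun _ b => b) (R false) +
      (1 / 2 : ℝ) • mapOutcomes (κ true) (fun _ b => b) (R true),
      convex_convexHull ℝ _ (mapOutcomes_mem_localSet _ _ (hR false))
        (mapOutcomes_mem_localSet _ _ (hR true)) (by norm_num) (by norm_num) (by norm_num),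
      fun x y a b => ?_⟩
    have : ∀ c, mapOutcomes (κ c) (fun _ b => b) (R c) x y (some a) (some b) =
        if bit x = c then R c x y (some a) (some b) else 0 := fun c => by
      by_cases h : bit x = c
      · simp [mapOutcomes, κ, h, ite_and]
      · simp [mapOutcomes, κ, h]
    simp only [Pi.add_apply, Pi.smul_apply, smul_eq_mul, this, CProtocol.run, hRv, pow_succ]
    rcases Bool.eq_false_or_eq_true (bit x) with h | h <;> simp [h] <;> ring_nf
  | bobSends bit next ih =>
    obtain ⟨t, rfl⟩ : ∃ k, t = k + 1 := ⟨t - 1, by simp only [CProtocol.cost] at ht; omega⟩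
    have hc : ∀ c, (next c).cost ≤ t := by
      simp only [CProtocol.cost] at ht
      rintro (_ | _) <;> omega
    choose R hR hRv using fun c => ih c (hc c)
    let η : Bool → Y → Option B → Option B := fun c y b => if bit y = c then b else none
    refine ⟨(1 / 2 : ℝ) • mapOutcomes (fun _ a => a) (η false) (R false) +
      (1 / 2 : ℝ) • mapOutcomes (fun _ a => a) (η true) (R true),
      convex_convexHull ℝ _ (mapOutcomes_mem_localSet _ _ (hR false))
        (mapOutcomes_mem_localSet _ _ (hR true)) (by norm_num) (by norm_num) (by norm_num),
      fun x y a b => ?_⟩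
    have : ∀ c, mapOutcomes (fun _ a => a) (η c) (R c) x y (some a) (some b) =
        if bit y = c then R c x y (some a) (some b) else 0 := fun c => by
      by_cases h : bit y = c
      · simp [mapOutcomes, η, h, ite_and]
      · simp [mapOutcomes, η, h]
    simp only [Pi.add_apply, Pi.smul_apply, smul_eq_mul, this, CProtocol.run, hRv, pow_succ]
    rcases Bool.eq_false_or_eq_true (bit y) with h | h <;> simp [h] <;> ring_nf

/-- The law `μ` may live on infinitely many protocols. Its image `ν` on input-output functions is a
law on a finite set, so a finite convex combination suffices, with one representative protocol for
each function of positive weight. -/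
theorem ClassicalSim.exists_postselection [Fintype X] [Fintype Y] [Fintype A] [Fintype B] {t : ℕ}
    {p : Table X Y A B} (h : ClassicalSim t p) :
    ∃ R ∈ localSet X Y (Option A) (Option B), ∀ x y a b,
      (2 : ℝ) ^ t * R x y (some a) (some b) = p x y a b := by
  classical
  obtain ⟨μ, hμ, hp⟩ := h
  let ν : PMF (X → Y → A × B) := μ.map CProtocol.run
  have hR : ∀ φ : X → Y → A × B, ∃ R ∈ localSet X Y (Option A) (Option B), ν φ ≠ 0 → ∀ x y a b,
      R x y (some a) (some b) = (1 / 2) ^ t * if φ x y = (a, b) then 1 else 0 := by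
    intro φ
    by_cases hφ : ν φ = 0
    · exact ⟨localDet (fun _ => none, fun _ => none), subset_convexHull ℝ _ ⟨_, rfl⟩,
        fun h => absurd hφ h⟩
    · obtain ⟨P, hP, rfl⟩ := (PMF.mem_support_map_iff _ _ _).1 ((PMF.mem_support_iff _ _).2 hφ)
      obtain ⟨R, hR, hRv⟩ := P.exists_postselection (hμ P hP)
      exact ⟨R, hR, fun _ => hRv⟩
  choose R hR hRv using hR
  refine ⟨∑ φ, (ν φ).toReal • R φ, (convex_convexHull ℝ _).sum_mem
    (fun φ _ => ENNReal.toReal_nonneg) ?_ (fun φ _ => hR φ), fun x y a b => ?_⟩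
  · rw [← ENNReal.toReal_sum fun φ _ => ν.apply_ne_top φ, ← tsum_fintype (L := .unconditional _),
      ν.tsum_coe, ENNReal.toReal_one]
  · have h1 : (μ.map fun P => P.run x y) = ν.map fun φ => φ x y := by
      rw [PMF.map_comp]; rfl
    rw [hp, h1, PMF.map_apply, tsum_fintype, ENNReal.toReal_sum (fun φ _ => by
      split_ifs
      · exact ν.apply_ne_top φ
      · exact ENNReal.zero_ne_top)]
    simp only [Finset.sum_apply, Pi.smul_apply, smul_eq_mul]
    rw [Finset.mul_sum]
    refine Finset.sum_congr rfl fun φ _ => ?_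
    by_cases hφ : ν φ = 0
    · simp [hφ]
    · rw [hRv φ hφ]
      have : (2 : ℝ) ^ t * (1 / 2) ^ t = 1 := by rw [← mul_pow]; norm_num
      by_cases hx : φ x y = (a, b)
      · simp only [hx, if_true, mul_one]
        linear_combination (ν φ).toReal * this
      · simp [hx, Ne.symm hx]

theorem nuTilde_le_of_classicalSim [Fintype X] [Fintype Y] [Fintype A] [Fintype B] [Nonempty X]
    [Nonempty Y] {t : ℕ} {p : Table X Y A B} (hp : NonSignaling p) (h : ClassicalSim t p) :
    nuTilde p ≤ 2 * 2 ^ t - 1 := by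
  obtain ⟨R, hR, hRp⟩ := h.exists_postselection
  exact affineCost_le_of_postselection hp (nonSignaling_of_mem_localSet hR)
    (one_le_pow₀ (by norm_num)) hRp (fun s t hs ht => prodTable_mem_localSet hs ht)
    (fun s t hs ht => fillTable_mem_localSet hs ht hR)

end Classical

end

noncomputable section

/-! ### Operators on some of the qubits -/

section ActsOn

set_option linter.unusedSectionVars false

variable {q : ℕ} {H : Type*} [NormedAddCommGroup H] [InnerProductSpace ℂ H] [CompleteSpace H]
  {𝒜 : StarSubalgebra ℂ (H →L[ℂ] H)} {S T : Set (Fin q)} {M N : QOp q H}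

theorem ActsOn.mono (h : ActsOn 𝒜 S M) (hST : S ⊆ T) : ActsOn 𝒜 T M where
  mem := h.mem
  eq_zero s t := fun ⟨i, hi, hne⟩ => h.eq_zero s t ⟨i, fun hS => hi (hST hS), hne⟩
  eq_of_agree s t s' t' h1 h2 := by
    -- If `s` and `t` differ outside `S`, they do so at a qubit of `T`, where `s'` and `t'` agree
    -- with them; both entries then vanish.
    by_cases hz : ∃ i, i ∉ S ∧ s i ≠ t i
    · obtain ⟨i, hi, hne⟩ := hz
      have hiT : i ∈ T := by
        by_contra hT
        exact hne (h2 i hT).1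
      rw [h.eq_zero s t ⟨i, hi, hne⟩, h.eq_zero s' t' ⟨i, hi, by rwa [← (h1 i hiT).1, ← (h1 i hiT).2]⟩]
    · push Not at hz
      refine h.eq_of_agree s t s' t' (fun i hi => h1 i (hST hi)) fun i hi => ⟨hz i hi, ?_⟩
      by_cases hiT : i ∈ T
      · rw [← (h1 i hiT).1, ← (h1 i hiT).2, hz i hi]
      · exact (h2 i hiT).2

theorem actsOn_one (𝒜 : StarSubalgebra ℂ (H →L[ℂ] H)) (S : Set (Fin q)) :
    ActsOn 𝒜 S (1 : QOp q H) where
  mem s t := by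
    rw [Matrix.one_apply]
    split_ifs
    · exact one_mem 𝒜
    · exact zero_mem 𝒜
  eq_zero s t := fun ⟨i, _, hne⟩ => Matrix.one_apply_ne fun h => hne (congrFun h i)
  eq_of_agree s t s' t' h1 h2 := by
    have : s = t ↔ s' = t' := by
      constructor <;> intro h <;> ext i <;> by_cases hi : i ∈ S <;> grind
    simp only [Matrix.one_apply, this]

theorem ActsOn.mul (hM : ActsOn 𝒜 S M) (hN : ActsOn 𝒜 S N) : ActsOn 𝒜 S (M * N) where
  mem s t := by
    rw [Matrix.mul_apply]
    exact sum_mem fun u _ => mul_mem (hM.mem s u) (hN.mem u t)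
  eq_zero s t := fun ⟨i, hi, hne⟩ => by
    rw [Matrix.mul_apply]
    refine Finset.sum_eq_zero fun u _ => ?_
    by_cases hu : s i = u i
    · rw [hN.eq_zero u t ⟨i, hi, by rwa [← hu]⟩, mul_zero]
    · rw [hM.eq_zero s u ⟨i, hi, hu⟩, zero_mul]
  eq_of_agree s t s' t' h1 h2 := by
    classical
    rw [Matrix.mul_apply, Matrix.mul_apply]
    -- A nonzero term forces `u = s` outside `S`; its partner keeps `u` on `S` and follows `s'`
    -- elsewhere.
    refine Finset.sum_bij_ne_zero (fun u _ _ i => if i ∈ S then u i else s' i) ?_ ?_ ?_ ?_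
    · simp
    · intro u _ hu v _ hv huv
      have hu' : ∀ i, i ∉ S → s i = u i := fun i hi => by
        by_contra h; exact hu (by rw [hM.eq_zero s u ⟨i, hi, h⟩, zero_mul])
      have hv' : ∀ i, i ∉ S → s i = v i := fun i hi => by
        by_contra h; exact hv (by rw [hM.eq_zero s v ⟨i, hi, h⟩, zero_mul])
      ext i
      have := congrFun huv i
      grind
    · intro u _ hu
      have hu' : ∀ i, i ∉ S → s' i = u i := fun i hi => by
        by_contra h; exact hu (by rw [hM.eq_zero s' u ⟨i, hi, h⟩, zero_mul])
      have e : M s' u * N u t' = M s (fun i => if i ∈ S then u i else s i) *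
          N (fun i => if i ∈ S then u i else s i) t := by
        congr 1
        · apply hM.eq_of_agree <;> grind
        · apply hN.eq_of_agree <;> grind
      refine ⟨fun i => if i ∈ S then u i else s i, Finset.mem_univ _, e ▸ hu, ?_⟩
      ext i
      grind
    · intro u _ hu
      have hu' : ∀ i, i ∉ S → s i = u i := fun i hi => by
        by_contra h; exact hu (by rw [hM.eq_zero s u ⟨i, hi, h⟩, zero_mul])
      congr 1
      · apply hM.eq_of_agree <;> grind
      · apply hN.eq_of_agree <;> grind

/-- The configuration that agrees with `r` where `c` holds, and with `s` elsewhere. -/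
def merge (c : Fin q → Bool) (r s : Fin q → Bool) : Fin q → Bool :=
  fun i => if c i then r i else s i

/-- The operators act on complementary sets of qubits, so a single intermediate configuration
contributes to each product, and the surviving entries commute because `𝒜` and `ℬ` do. -/
theorem ActsOn.mul_comm {ℬ : StarSubalgebra ℂ (H →L[ℂ] H)}
    (hcomm : ∀ S ∈ 𝒜, ∀ T ∈ ℬ, S * T = T * S) {c : Fin q → Bool}
    (hM : ActsOn 𝒜 {i | c i = false} M) (hN : ActsOn ℬ {i | c i = true} N) :
    M * N = N * M := by
  ext1 s t
  rw [Matrix.mul_apply, Matrix.mul_apply, Finset.sum_eq_single (merge c s t),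
    Finset.sum_eq_single (merge c t s), hcomm _ (hM.mem _ _) _ (hN.mem _ _)]
  · congr 1
    · apply hN.eq_of_agree <;> intro i hi <;> simp_all [merge]
    · apply hM.eq_of_agree <;> intro i hi <;> simp_all [merge]
  · intro u _ hu
    by_cases h : ∀ i, c i = false → s i = u i
    · rw [hM.eq_zero, mul_zero]
      by_contra h'
      push Not at h'
      apply hu
      ext i
      have := h i
      have := h' i
      simp only [merge]
      grind
    · push Not at h
      obtain ⟨i, hi, hne⟩ := h
      rw [hN.eq_zero s u ⟨i, by simp [hi], hne⟩, zero_mul]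
  · simp
  · intro u _ hu
    by_cases h : ∀ i, c i = true → s i = u i
    · rw [hN.eq_zero, mul_zero]
      by_contra h'
      push Not at h'
      apply hu
      ext i
      have := h i
      have := h' i
      simp only [merge]
      grind
    · push Not at h
      obtain ⟨i, hi, hne⟩ := h
      rw [hM.eq_zero s u ⟨i, by simp [hi], hne⟩, zero_mul]
  · simp

/-- The amplitudes of the state obtained by linking an operator `P` of the player who sends the
qubits where `c` holds with an operator `Q` of the other player. Every qubit starts in `|0⟩`, is
first acted on by its sender, and then, from the configuration `r` on, by its receiver. -/
def link (c : Fin q → Bool) (P Q : QOp q H) (f : Fin q → Bool) : H →L[ℂ] H :=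
  ∑ r, P (merge c r f) (merge c (fun _ => false) r) * Q (merge c f r) (merge c r fun _ => false)

/-- The symmetry between the players: what `link_mul` proves for the first player transfers to the
second. -/
theorem link_swap {ℬ : StarSubalgebra ℂ (H →L[ℂ] H)}
    (hcomm : ∀ S ∈ 𝒜, ∀ T ∈ ℬ, S * T = T * S) (c : Fin q → Bool) {P Q : QOp q H}
    (hP : ∀ s t, P s t ∈ 𝒜) (hQ : ∀ s t, Q s t ∈ ℬ) (f : Fin q → Bool) :
    link (fun i => !c i) Q P f = link c P Q f := by
  refine Finset.sum_congr rfl fun r _ => ?_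
  have : ∀ s t, merge (fun i => !c i) s t = merge c t s := fun s t => by
    ext i; simp only [merge]; grind
  simp only [this]
  rw [hcomm _ (hP _ _) _ (hQ _ _)]

theorem link_one (c : Fin q → Bool) (f : Fin q → Bool) :
    link c (1 : QOp q H) 1 f = (1 : QOp q H) f fun _ => false := by
  rw [link, Finset.sum_eq_single fun _ => false]
  · by_cases h : f = fun _ => false
    · subst h; simp
    · rw [Matrix.one_apply_ne h]
      have : merge c (fun _ => false) f ≠ merge c (fun _ => false) (fun _ => false) ∨
          merge c f (fun _ => false) ≠ merge c (fun _ => false) fun _ => false := by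
        by_contra h'
        push Not at h'
        apply h
        ext i
        have h1 := congrFun h'.1 i
        have h2 := congrFun h'.2 i
        simp only [merge] at h1 h2
        grind
      rcases this with h | h
      · rw [Matrix.one_apply_ne h, zero_mul]
      · rw [Matrix.one_apply_ne h, mul_zero]
  · intro r _ hr
    have : merge c r f ≠ merge c (fun _ => false) r ∨
        merge c f r ≠ merge c r fun _ => false := by
      by_contra h'
      push Not at h'
      apply hr
      ext i
      have h1 := congrFun h'.1 i
      have h2 := congrFun h'.2 i
      simp only [merge] at h1 h2
      grind
    rcases this with h | h
    · rw [Matrix.one_apply_ne h, zero_mul]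
    · rw [Matrix.one_apply_ne h, mul_zero]
  · simp

/-- An operator on the qubits received by the first player, and on some of his own qubits `D` that
have not been used before, can be absorbed into his part of the link. -/
theorem link_mul {ℬ : StarSubalgebra ℂ (H →L[ℂ] H)} {c : Fin q → Bool} {D : Set (Fin q)}
    (hD : ∀ i ∈ D, c i = true) {U P Q : QOp q H} (hU : ActsOn 𝒜 ({i | c i = false} ∪ D) U)
    (hP : ActsOn 𝒜 Dᶜ P) (hQ : ActsOn ℬ Dᶜ Q) (f : Fin q → Bool) :
    link c (U * P) Q f = ∑ t, U f t * link c P Q t := by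
  classical
  simp only [link, Matrix.mul_apply, Finset.sum_mul, Finset.mul_sum]
  rw [← Finset.sum_product', ← Finset.sum_product']
  have nz : ∀ {u p k : H →L[ℂ] H}, u * p * k ≠ 0 → u ≠ 0 ∧ p ≠ 0 ∧ k ≠ 0 := by
    intro u p k h
    refine ⟨?_, ?_, ?_⟩ <;> rintro rfl <;> simp at h
  have nU : ∀ {s t}, U s t ≠ 0 → ∀ i, c i = true → i ∉ D → s i = t i := fun {s t} h i hi hiD => by
    by_contra h'; exact h (hU.eq_zero s t ⟨i, by simp [hi, hiD], h'⟩)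
  have nP : ∀ {s t}, P s t ≠ 0 → ∀ i, i ∈ D → s i = t i := fun {s t} h i hi => by
    by_contra h'; exact h (hP.eq_zero s t ⟨i, by simp [hi], h'⟩)
  have nQ : ∀ {s t}, Q s t ≠ 0 → ∀ i, i ∈ D → s i = t i := fun {s t} h i hi => by
    by_contra h'; exact h (hQ.eq_zero s t ⟨i, by simp [hi], h'⟩)
  -- Matching of the nonzero terms. On a fresh qubit of `D`, the left side has `r = f` after `U` and
  -- `t = 0` before it, while on the right both variables are `0`. On the first player's other sent
  -- qubits `U` is the identity, so `r = t` on the left and `t = f` on the right. On received qubits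
  -- nothing changes.
  refine Finset.sum_bij_ne_zero (fun x _ _ =>
    (merge c (fun i => if i ∈ D then false else f i) x.2, fun i => if i ∈ D then false else x.1 i))
    ?_ ?_ ?_ ?_
  · simp
  · rintro ⟨r, t⟩ - h ⟨r', t'⟩ - h' he
    obtain ⟨hU1, hP1, hQ1⟩ := nz h
    obtain ⟨hU2, hP2, hQ2⟩ := nz h'
    rw [Prod.mk.injEq] at he ⊢
    have hr : r = r' := by
      ext i
      have e2 := congrFun he.2 i
      have a1 := nQ hQ1 i
      have a2 := nQ hQ2 i
      have a3 := hD i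
      simp only [merge] at a1 a2 e2
      grind
    refine ⟨hr, ?_⟩
    subst hr
    ext i
    have e1 := congrFun he.1 i
    have a1 := nP hP1 i
    have a2 := nP hP2 i
    have a3 := hD i
    have a4 := nU hU1 i
    have a5 := nU hU2 i
    simp only [merge] at a1 a2 e1 a4 a5
    grind
  · rintro ⟨t, r⟩ - h
    rw [← mul_assoc] at h
    obtain ⟨hU1, hP1, hQ1⟩ := nz h
    have a1 := nU hU1
    have a2 := nP hP1
    have a3 := nQ hQ1
    simp only [merge] at a1 a2 a3
    have eU : U (merge c (fun i => if i ∈ D then f i else r i) f) (merge c r t) = U f t := by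
      apply hU.eq_of_agree <;> intro i hi <;> simp only [merge] <;> grind
    have eP : P (merge c r t) (merge c (fun _ => false) fun i => if i ∈ D then f i else r i) =
        P (merge c r t) (merge c (fun _ => false) r) := by
      congr 1; ext i; simp only [merge]; grind
    have eQ : Q (merge c f fun i => if i ∈ D then f i else r i)
        (merge c (fun i => if i ∈ D then f i else r i) fun _ => false) =
        Q (merge c t r) (merge c r fun _ => false) := by
      apply hQ.eq_of_agree <;> intro i hi <;> simp only [merge] <;> grind
    refine ⟨(fun i => if i ∈ D then f i else r i, merge c r t), Finset.mem_univ _, ?_, ?_⟩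
    · simp only [eU, eP, eQ]; exact h
    · rw [Prod.mk.injEq]
      constructor
      · ext i; simp only [merge]; grind
      · ext i; grind
  · rintro ⟨r, t⟩ - h
    obtain ⟨hU1, hP1, hQ1⟩ := nz h
    have a1 := nU hU1
    have a2 := nP hP1
    have a3 := nQ hQ1
    simp only [merge] at a1 a2 a3
    rw [mul_assoc]
    congr 1
    · apply hU.eq_of_agree <;> intro i hi <;> simp only [merge] <;> grind
    congr 1
    · congr 1 <;> ext i <;> simp only [merge] <;> grind
    · apply hQ.eq_of_agree <;> intro i hi <;> simp only [merge] <;> grind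

end ActsOn
end

noncomputable section

/-! ### The two players' parts of a quantum protocol -/

/-- The product of the first `k` factors, the first one acting first. -/
def partialProd {M : Type*} [Monoid M] {q : ℕ} (g : Fin q → M) : ℕ → M
  | 0 => 1
  | k + 1 => (if h : k < q then g ⟨k, h⟩ else 1) * partialProd g k

theorem partialProd_eq_prod_take {M : Type*} [Monoid M] {q : ℕ} (g : Fin q → M) (k : ℕ) :
    partialProd g k = ((List.ofFn g).take k).reverse.prod := by
  induction k with
  | zero => simp [partialProd]
  | succ k ih =>
    rw [partialProd, ih]
    split_ifs with h
    · rw [← List.take_append_getElem (by simpa using h)]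
      simp
    · rw [List.take_of_length_le (by simpa using h), List.take_of_length_le (by simp; omega),
        one_mul]

theorem partialProd_eq_prod {M : Type*} [Monoid M] {q : ℕ} (g : Fin q → M) :
    partialProd g q = (List.ofFn g).reverse.prod := by
  rw [partialProd_eq_prod_take, List.take_of_length_le (by simp)]

theorem partialProd_mem {M : Type*} [Monoid M] {q : ℕ} {g : Fin q → M} {S : Submonoid M}
    (h : ∀ i, g i ∈ S) (k : ℕ) : partialProd g k ∈ S := by
  induction k with
  | zero => exact S.one_mem
  | succ k ih =>
    refine S.mul_mem ?_ ih
    split_ifs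
    · exact h _
    · exact S.one_mem

/-- Qubit `k` is still untouched after the first `k` rounds, which is the freshness that `link_mul`
needs. -/
theorem partialProd_acts {q : ℕ} {H : Type*} [NormedAddCommGroup H] [InnerProductSpace ℂ H]
    [CompleteSpace H] {𝒜 : StarSubalgebra ℂ (H →L[ℂ] H)} {g : Fin q → QOp q H}
    (h : ∀ i, ActsOn 𝒜 {j | j ≤ i} (g i)) (k : ℕ) :
    ActsOn 𝒜 {j | j.1 < k} (partialProd g k) := by
  induction k with
  | zero => exact actsOn_one _ _
  | succ k ih =>
    refine ActsOn.mul ?_ (ih.mono fun j hj => Nat.lt_succ_of_lt hj)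
    split_ifs
    · exact (h _).mono fun j hj => Nat.lt_succ_of_le hj
    · exact actsOn_one _ _

namespace QProtocol

variable {X Y A B : Type*} [Fintype A] [Fintype B] {q : ℕ} {H : Type*}
  [NormedAddCommGroup H] [InnerProductSpace ℂ H] [CompleteSpace H]

/-- Whether Alice is the sender of a qubit. -/
def fromAlice (π : QProtocol X Y A B q H) (i : Fin q) : Bool :=
  match π.sender i with
  | .alice => true
  | .bob => false

theorem fromAlice_eq_true_iff (π : QProtocol X Y A B q H) (i : Fin q) :
    π.fromAlice i = true ↔ π.sender i = .alice := by
  unfold fromAlice; cases π.sender i <;> simp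

theorem fromAlice_eq_false_iff (π : QProtocol X Y A B q H) (i : Fin q) :
    π.fromAlice i = false ↔ π.sender i = .bob := by
  unfold fromAlice; cases π.sender i <;> simp

/-- The product of Alice's operators in the first `k` rounds. -/
def partA (π : QProtocol X Y A B q H) (x : X) (k : ℕ) : QOp q H :=
  partialProd (fun i => if π.fromAlice i then π.opA x i else 1) k

/-- The product of Bob's operators in the first `k` rounds. -/
def partB (π : QProtocol X Y A B q H) (y : Y) (k : ℕ) : QOp q H :=
  partialProd (fun i => if π.fromAlice i then 1 else π.opB y i) k

variable (π : QProtocol X Y A B q H)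

theorem partA_unitary (x : X) (k : ℕ) : π.partA x k ∈ unitary (QOp q H) := by
  refine partialProd_mem (fun i => ?_) k
  by_cases h : π.fromAlice i = true
  · rw [if_pos h]; exact π.opA_unitary x i ((π.fromAlice_eq_true_iff i).1 h)
  · rw [if_neg h]; exact one_mem (unitary (QOp q H))

theorem partB_unitary (y : Y) (k : ℕ) : π.partB y k ∈ unitary (QOp q H) := by
  refine partialProd_mem (fun i => ?_) k
  by_cases h : π.fromAlice i = true
  · rw [if_pos h]; exact one_mem (unitary (QOp q H))
  · rw [if_neg h]; exact π.opB_unitary y i ((π.fromAlice_eq_false_iff i).1 (by simpa using h))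

theorem partA_acts (x : X) (k : ℕ) : ActsOn π.algA {j | j.1 < k} (π.partA x k) := by
  refine partialProd_acts (fun i => ?_) k
  by_cases h : π.fromAlice i = true
  · rw [if_pos h]
    refine (π.opA_acts x i ((π.fromAlice_eq_true_iff i).1 h)).mono ?_
    rintro j (⟨hj, -⟩ | rfl)
    · exact hj.le
    · simp
  · rw [if_neg h]; exact actsOn_one _ _

theorem partB_acts (y : Y) (k : ℕ) : ActsOn π.algB {j | j.1 < k} (π.partB y k) := by
  refine partialProd_acts (fun i => ?_) k
  by_cases h : π.fromAlice i = true
  · rw [if_pos h]; exact actsOn_one _ _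
  · rw [if_neg h]
    refine (π.opB_acts y i ((π.fromAlice_eq_false_iff i).1 (by simpa using h))).mono ?_
    rintro j (⟨hj, -⟩ | rfl)
    · exact hj.le
    · simp

/-- The interleaved rounds separate into Alice's product and Bob's. Each round is absorbed into the
part of its player by `link_mul` with `D = {k}`; a round of Bob is first brought to the left by
`link_swap`. -/
theorem partialProd_roundOp_apply (x : X) (y : Y) {k : ℕ} (hk : k ≤ q) (f : Fin q → Bool) :
    partialProd (π.roundOp x y) k f (fun _ => false) =
      link π.fromAlice (π.partA x k) (π.partB y k) f := by
  induction k generalizing f with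
  | zero => exact (link_one _ _).symm
  | succ k ih =>
    have hkq : k < q := hk
    have hA := π.partA_acts x k
    have hB := π.partB_acts y k
    have sub : {j : Fin q | j.1 < k} ⊆ ({⟨k, hkq⟩}ᶜ : Set (Fin q)) := by
      rintro j hj rfl
      exact lt_irrefl k hj
    rw [partialProd, dif_pos hkq, Matrix.mul_apply]
    simp only [ih hkq.le]
    cases hs : π.sender ⟨k, hkq⟩ with
    | alice =>
      have hc := (π.fromAlice_eq_true_iff ⟨k, hkq⟩).2 hs
      have e1 : π.partA x (k + 1) = π.opA x ⟨k, hkq⟩ * π.partA x k := by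
        simp only [partA, partialProd, dif_pos hkq, hc, if_true]
      have e2 : π.partB y (k + 1) = π.partB y k := by
        simp only [partB, partialProd, dif_pos hkq, hc, if_true, one_mul]
      have e3 : π.roundOp x y ⟨k, hkq⟩ = π.opA x ⟨k, hkq⟩ := by simp only [roundOp, hs]
      rw [e1, e2, e3]
      refine (link_mul (D := {⟨k, hkq⟩}) ?_ ((π.opA_acts x _ hs).mono ?_) (hA.mono sub)
        (hB.mono sub) f).symm
      · rintro i rfl; exact hc
      · refine Set.union_subset_union_left _ ?_
        rintro j ⟨-, hj⟩
        exact (π.fromAlice_eq_false_iff j).2 hj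
    | bob =>
      have hc := (π.fromAlice_eq_false_iff ⟨k, hkq⟩).2 hs
      have e1 : π.partB y (k + 1) = π.opB y ⟨k, hkq⟩ * π.partB y k := by
        simp only [partB, partialProd, dif_pos hkq, hc, if_false, Bool.false_eq_true]
      have e2 : π.partA x (k + 1) = π.partA x k := by
        simp only [partA, partialProd, dif_pos hkq, hc, if_false, one_mul, Bool.false_eq_true]
      have e3 : π.roundOp x y ⟨k, hkq⟩ = π.opB y ⟨k, hkq⟩ := by simp only [roundOp, hs]
      have hB' := π.partB_acts y (k + 1)
      rw [e1] at hB'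
      rw [e1, e2, e3, ← link_swap π.commute π.fromAlice hA.mem hB'.mem]
      simp only [← link_swap π.commute π.fromAlice hA.mem hB.mem]
      refine (link_mul (D := {⟨k, hkq⟩}) ?_ ((π.opB_acts y _ hs).mono ?_) (hB.mono sub)
        (hA.mono sub) f).symm
      · rintro i rfl; simp [hc]
      · refine Set.union_subset_union_left _ ?_
        rintro j ⟨-, hj⟩
        simpa using (π.fromAlice_eq_true_iff j).2 hj

/-- Alice's part of the protocol, followed by her measurement. -/
def finalA (x : X) (a : A) : QOp q H := π.measA x a * π.partA x q

/-- Bob's part of the protocol, followed by his measurement. -/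
def finalB (y : Y) (b : B) : QOp q H := π.measB y b * π.partB y q

theorem measA_acts' (x : X) (a : A) : ActsOn π.algA {i | π.fromAlice i = false} (π.measA x a) :=
  (π.measA_acts x a).mono fun i hi => (π.fromAlice_eq_false_iff i).2 hi

theorem measB_acts' (y : Y) (b : B) : ActsOn π.algB {i | π.fromAlice i = true} (π.measB y b) :=
  (π.measB_acts y b).mono fun i hi => (π.fromAlice_eq_true_iff i).2 hi

theorem finalA_mem (x : X) (a : A) (s t : Fin q → Bool) : π.finalA x a s t ∈ π.algA :=
  (((π.measA_acts x a).mono (Set.subset_univ _)).mul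
    ((π.partA_acts x q).mono (Set.subset_univ _))).mem s t

theorem finalB_mem (y : Y) (b : B) (s t : Fin q → Bool) : π.finalB y b s t ∈ π.algB :=
  (((π.measB_acts y b).mono (Set.subset_univ _)).mul
    ((π.partB_acts y q).mono (Set.subset_univ _))).mem s t

/-- The measurements touch received qubits only, so they are absorbed in the same way with `D = ∅`,
Bob's first and then Alice's. -/
theorem meas_mul_totalOp_apply (x : X) (y : Y) (a : A) (b : B) (f : Fin q → Bool) :
    (π.measA x a * (π.measB y b * π.totalOp x y)) f (fun _ => false) =
      link π.fromAlice (π.finalA x a) (π.finalB y b) f := by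
  have hA := (π.partA_acts x q).mono (Set.subset_univ _)
  have hB := (π.partB_acts y q).mono (Set.subset_univ _)
  have hB' : ∀ g, (π.measB y b * π.totalOp x y) g (fun _ => false) =
      link π.fromAlice (π.partA x q) (π.finalB y b) g := fun g => by
    have e : π.totalOp x y = partialProd (π.roundOp x y) q := (partialProd_eq_prod _).symm
    rw [Matrix.mul_apply, e]
    simp only [π.partialProd_roundOp_apply x y le_rfl]
    rw [← link_swap π.commute π.fromAlice hA.mem (π.finalB_mem y b)]
    simp only [← link_swap π.commute π.fromAlice hA.mem hB.mem]
    refine (link_mul (D := ∅) (by simp) ((π.measB_acts' y b).mono ?_) (by simpa using hB)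
      (by simpa using hA) g).symm
    intro i hi
    simpa using hi
  rw [Matrix.mul_apply]
  simp only [hB']
  refine (link_mul (ℬ := π.algB) (D := ∅) (by simp) ((π.measA_acts' x a).mono (by simp))
    (by simpa using hA) ?_ f).symm
  simpa [finalB] using ((π.measB_acts y b).mono (Set.subset_univ _)).mul hB

/-- The two projections commute, so their product is a projection and the expectation is the squared
norm of the projected final state. -/
theorem prob_eq_sum (x : X) (y : Y) (a : A) (b : B) : π.prob x y a b =
    ((∑ f, ‖link π.fromAlice (π.finalA x a) (π.finalB y b) f π.ψ‖ ^ 2 : ℝ) : ℂ) := by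
  set Z : QOp q H := π.measA x a * (π.measB y b * π.totalOp x y) with hZ
  have hc : π.measA x a * π.measB y b = π.measB y b * π.measA x a :=
    ActsOn.mul_comm π.commute (π.measA_acts' x a) (π.measB_acts' y b)
  have hMM : π.measA x a * π.measA x a = π.measA x a := by simp [(π.measA_proj x).mul_eq]
  have hNN : π.measB y b * π.measB y b = π.measB y b := by simp [(π.measB_proj y).mul_eq]
  have e : star (π.totalOp x y) * (π.measA x a * π.measB y b) * π.totalOp x y = star Z * Z := by
    have : star Z * Z = star (π.totalOp x y) *
        (π.measB y b * (π.measA x a * π.measA x a) * π.measB y b) * π.totalOp x y := by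
      simp only [hZ, star_mul, (π.measA_proj x).selfAdjoint, (π.measB_proj y).selfAdjoint, mul_assoc]
    rw [this, hMM, mul_assoc (π.measB y b), hc, ← mul_assoc (π.measB y b), hNN, ← hc]
  rw [prob, e, Matrix.mul_apply, sum_apply, inner_sum]
  push_cast
  refine Finset.sum_congr rfl fun f _ => ?_
  change inner ℂ π.ψ (ContinuousLinearMap.adjoint (Z f _) (Z f _ π.ψ)) = _
  rw [ContinuousLinearMap.adjoint_inner_right, hZ, meas_mul_totalOp_apply, inner_self_eq_norm_sq_to_K]
  rfl

end QProtocol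
/-! ### Combs -/

/-- The family `L a k g h` of operators describes a party that receives a register `β` in the
state `h`, sends a register `α` in the state `k`, and is left with the outcome `a` and the
register `β` in the state `g`. -/
def IsComb {A α β K : Type*} [Fintype A] [Fintype α] [Fintype β] [DecidableEq β]
    [NormedAddCommGroup K] [InnerProductSpace ℂ K] [CompleteSpace K]
    (L : A → α → β → β → K →L[ℂ] K) : Prop :=
  ∀ h' h, ∑ a, ∑ k, ∑ g, star (L a k g h') * L a k g h = if h' = h then 1 else 0

/-- The comb identity is the entry `(j h', j h)` of `∑ (M a W)* (M a W) = 1`. The map `j` adjoins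
the fixed initial state of the player's own qubits. -/
theorem isComb_of_unitary {A α β σ K : Type*} [Fintype A] [Fintype α] [Fintype β] [DecidableEq β]
    [Fintype σ] [DecidableEq σ] [NormedAddCommGroup K] [InnerProductSpace ℂ K] [CompleteSpace K]
    {M : A → Matrix σ σ (K →L[ℂ] K)} (hM : IsProjMeas M) {W : Matrix σ σ (K →L[ℂ] K)}
    (hW : W ∈ unitary (Matrix σ σ (K →L[ℂ] K))) (e : α × β ≃ σ) {j : β → σ}
    (hj : Function.Injective j) :
    IsComb fun a k g h => (M a * W) (e (k, g)) (j h) := by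
  intro h' h
  have key : ∑ a, star (M a * W) * (M a * W) = 1 := by
    have : ∀ a, star (M a * W) * (M a * W) = star W * M a * W := fun a => by
      have hMM : M a * M a = M a := by simp [hM.mul_eq]
      calc star (M a * W) * (M a * W) = star W * (M a * M a) * W := by
            simp only [star_mul, hM.selfAdjoint, mul_assoc]
        _ = _ := by rw [hMM]
    simp only [this]
    rw [← Finset.sum_mul, ← Finset.mul_sum, hM.sum_eq_one, mul_one,
      Unitary.star_mul_self_of_mem hW]
  have h2 := congrFun (congrFun key (j h')) (j h)
  rw [Matrix.sum_apply, Matrix.one_apply] at h2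
  simp only [hj.eq_iff] at h2
  rw [← h2]
  refine Finset.sum_congr rfl fun a _ => ?_
  rw [← Fintype.sum_prod_type' (f := fun k g => star ((M a * W) (e (k, g)) (j h')) *
    (M a * W) (e (k, g)) (j h)), Matrix.mul_apply, ← Equiv.sum_comp e]
  rfl

/-- The registers `α` and `β` hold the configurations of the qubits sent by Alice and by Bob. In
these coordinates `link` is a contraction of the two combs over `k` and `h`. -/
theorem QProtocol.exists_comb {X Y A B : Type*} [Fintype A] [Fintype B] {q : ℕ} {H : Type*}
    [NormedAddCommGroup H] [InnerProductSpace ℂ H] [CompleteSpace H]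
    (π : QProtocol X Y A B q H) :
    ∃ (α β : Type) (_ : Fintype α) (_ : Fintype β) (_ : DecidableEq α) (_ : DecidableEq β)
      (L : X → A → α → β → β → H →L[ℂ] H) (R : Y → B → β → α → α → H →L[ℂ] H),
      Fintype.card α * Fintype.card β = 2 ^ q ∧ (∀ x, IsComb (L x)) ∧ (∀ y, IsComb (R y)) ∧
      (∀ x y a b k g h k' g' h', Commute (L x a k g h) (R y b k' g' h')) ∧
      (∀ x y a b k g h k' g' h', Commute (star (L x a k g h)) (R y b k' g' h')) ∧
      ∀ x y a b, π.prob x y a b = ((∑ f, ∑ g,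
        ‖∑ k, ∑ h, (L x a k g h * R y b h f k) π.ψ‖ ^ 2 : ℝ) : ℂ) := by
  let c := π.fromAlice
  let e := (Equiv.piEquivPiSubtypeProd (fun i => c i = true) (fun _ : Fin q => Bool)).symm
  let z : Fin q → Bool := fun _ => false
  have he : ∀ r s, merge c (e r) (e s) = e (r.1, s.2) := fun r s => by
    ext i
    simp only [merge, e, Equiv.piEquivPiSubtypeProd_symm_apply]
    split_ifs <;> rfl
  obtain ⟨z₀, hz₀⟩ := e.surjective z
  refine ⟨{i // c i = true} → Bool, {i // ¬ c i = true} → Bool, inferInstance, inferInstance,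
    inferInstance, inferInstance, fun x a k g h => π.finalA x a (e (k, g)) (e (z₀.1, h)),
    fun y b h f k => π.finalB y b (e (f, h)) (e (k, z₀.2)), ?_, fun x => ?_, fun y => ?_,
    ?_, ?_, fun x y a b => ?_⟩
  · rw [← Fintype.card_prod, Fintype.card_congr e]
    simp
  · refine isComb_of_unitary (π.measA_proj x) (π.partA_unitary x q) e fun h h' hh => ?_
    simpa using hh
  · refine isComb_of_unitary (π.measB_proj y) (π.partB_unitary y q)
      ((Equiv.prodComm _ _).trans e) (j := fun k => e (k, z₀.2)) fun h h' hh => ?_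
    simpa using hh
  · intro x y a b k g h k' g' h'
    exact π.commute _ (π.finalA_mem x a _ _) _ (π.finalB_mem y b _ _)
  · intro x y a b k g h k' g' h'
    exact π.commute _ (star_mem (π.finalA_mem x a _ _)) _ (π.finalB_mem y b _ _)
  · rw [π.prob_eq_sum, ← Equiv.sum_comp e, Fintype.sum_prod_type]
    congr 1
    refine Finset.sum_congr rfl fun f _ => Finset.sum_congr rfl fun g _ => ?_
    congr 2
    rw [link, ← Equiv.sum_comp e, Fintype.sum_prod_type, sum_apply]
    refine Finset.sum_congr rfl fun k _ => ?_
    rw [sum_apply]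
    refine Finset.sum_congr rfl fun h _ => ?_
    change (π.finalA x a (merge c (e (k, h)) (e (f, g))) (merge c z (e (k, h))) *
      π.finalB y b (merge c (e (f, g)) (e (k, h))) (merge c (e (k, h)) z)) π.ψ = _
    rw [← hz₀, he, he, he, he]

end

noncomputable section

theorem sum_sum_sum_rotate {ι κ μ E : Type*} [Fintype ι] [Fintype κ] [Fintype μ] [AddCommMonoid E]
    (F : ι → κ → μ → E) : ∑ i, ∑ j, ∑ k, F i j k = ∑ j, ∑ k, ∑ i, F i j k := by
  rw [Finset.sum_comm]
  exact Finset.sum_congr rfl fun j _ => Finset.sum_comm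

/-- The matrix of the positive operator on the sent and received registers that describes the
outcome `a` of a comb, normalized so that the sum over the outcomes is at most `1`. -/
def combMat {A α β K : Type*} [Fintype α] [Fintype β] [NormedAddCommGroup K]
    [InnerProductSpace ℂ K] [CompleteSpace K] (L : A → α → β → β → K →L[ℂ] K) (a : A) :
    Matrix (α × β) (α × β) (K →L[ℂ] K) :=
  (Fintype.card α : ℂ)⁻¹ • (Matrix.conjTranspose (Matrix.of fun g r => L a r.1 g r.2) *
    (Matrix.of fun g r => L a r.1 g r.2 : Matrix β (α × β) (K →L[ℂ] K)))

theorem combMat_apply {A α β K : Type*} [Fintype α] [Fintype β] [NormedAddCommGroup K]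
    [InnerProductSpace ℂ K] [CompleteSpace K] (L : A → α → β → β → K →L[ℂ] K) (a : A)
    (r' r : α × β) : combMat L a r' r = (Fintype.card α : ℂ)⁻¹ • ∑ g, star (L a r'.1 g r'.2) * L a r.1 g r.2 := by
  simp [combMat, Matrix.mul_apply]

section Comb

set_option linter.unusedSectionVars false

variable {A α β K : Type*} [Fintype A] [Fintype α] [Fintype β] [DecidableEq β]
  [NormedAddCommGroup K] [InnerProductSpace ℂ K] [CompleteSpace K]

/-- The comb identity says that `w ↦ (∑ h, L a k g h (w h))` is an isometry. -/
theorem IsComb.sum_norm_sq {L : A → α → β → β → K →L[ℂ] K} (hL : IsComb L) (w : β → K) :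
    ∑ a, ∑ k, ∑ g, ‖∑ h, L a k g h (w h)‖ ^ 2 = ∑ h, ‖w h‖ ^ 2 := by
  have key : ((∑ a, ∑ k, ∑ g, ‖∑ h, L a k g h (w h)‖ ^ 2 : ℝ) : ℂ) =
      ((∑ h, ‖w h‖ ^ 2 : ℝ) : ℂ) := by
    calc ((∑ a, ∑ k, ∑ g, ‖∑ h, L a k g h (w h)‖ ^ 2 : ℝ) : ℂ)
        = ∑ a, ∑ k, ∑ g, ∑ h', ∑ h, inner ℂ (w h') ((star (L a k g h') * L a k g h) (w h)) := by
          simp only [Complex.ofReal_sum, Complex.ofReal_pow]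
          refine Finset.sum_congr rfl fun a _ => Finset.sum_congr rfl fun k _ =>
            Finset.sum_congr rfl fun g _ => ?_
          have h0 := inner_self_eq_norm_sq_to_K (𝕜 := ℂ) (∑ h, L a k g h (w h))
          rw [sum_inner] at h0
          refine h0.symm.trans (Finset.sum_congr rfl fun h' _ => ?_)
          rw [inner_sum]
          refine Finset.sum_congr rfl fun h _ => ?_
          exact (ContinuousLinearMap.adjoint_inner_right (L a k g h') (w h') _).symm
      _ = ∑ h', ∑ h, inner ℂ (w h') ((∑ a, ∑ k, ∑ g, star (L a k g h') * L a k g h) (w h)) := by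
          simp only [sum_apply, inner_sum]
          exact (Finset.sum_congr rfl fun a _ => (Finset.sum_congr rfl fun k _ =>
            sum_sum_sum_rotate _).trans (sum_sum_sum_rotate _)).trans (sum_sum_sum_rotate _)
      _ = ((∑ h, ‖w h‖ ^ 2 : ℝ) : ℂ) := by
          simp only [Complex.ofReal_sum, Complex.ofReal_pow]
          refine Finset.sum_congr rfl fun h' _ => ?_
          rw [Finset.sum_eq_single h']
          · rw [hL h' h', if_pos rfl]
            exact inner_self_eq_norm_sq_to_K (𝕜 := ℂ) (w h')
          · intro h _ hne
            rw [hL h' h, if_neg hne.symm]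
            simp
          · simp
  exact_mod_cast key

theorem IsComb.map {K' : Type*} [NormedAddCommGroup K'] [InnerProductSpace ℂ K'] [CompleteSpace K']
    {L : A → α → β → β → K →L[ℂ] K} (hL : IsComb L)
    (φ : (K →L[ℂ] K) →⋆ₐ[ℂ] (K' →L[ℂ] K')) : IsComb fun a k g h => φ (L a k g h) := by
  intro h' h
  simp only [← map_star, ← map_mul, ← map_sum, hL h' h]
  split_ifs <;> simp

theorem inner_combMat (L : A → α → β → β → K →L[ℂ] K) (a : A) (v : DirectSumSpace (α × β) K) :
    inner ℂ v (opMat (combMat L a) v) =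
      (((Fintype.card α : ℝ)⁻¹ * ∑ g, ‖∑ k, ∑ h, L a k g h (v (k, h))‖ ^ 2 : ℝ) : ℂ) := by
  rw [combMat, opMat_smul, opMat_mul, opMat_conjTranspose, smul_apply,
    inner_smul_right, ContinuousLinearMap.comp_apply, ContinuousLinearMap.adjoint_inner_right,
    PiLp.inner_apply]
  push_cast
  congr 1
  refine Finset.sum_congr rfl fun g _ => ?_
  rw [inner_self_eq_norm_sq_to_K, opMat_apply, Fintype.sum_prod_type]
  rfl

theorem opMat_combMat_nonneg (L : A → α → β → β → K →L[ℂ] K) (a : A) :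
    0 ≤ opMat (combMat L a) := by
  rw [ContinuousLinearMap.nonneg_iff_isPositive, ContinuousLinearMap.isPositive_iff_complex]
  intro v
  have h := inner_combMat L a v
  have h' : inner ℂ (opMat (combMat L a) v) v =
      (((Fintype.card α : ℝ)⁻¹ * ∑ g, ‖∑ k, ∑ h, L a k g h (v (k, h))‖ ^ 2 : ℝ) : ℂ) := by
    rw [← inner_conj_symm, h, Complex.conj_ofReal]
  rw [h']
  rw [RCLike.re_to_complex, Complex.ofReal_re]
  refine ⟨rfl, ?_⟩
  positivity

theorem norm_sum_sq_le_card_mul {ι : Type*} [Fintype ι] (v : ι → K) :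
    ‖∑ i, v i‖ ^ 2 ≤ Fintype.card ι * ∑ i, ‖v i‖ ^ 2 := by
  calc ‖∑ i, v i‖ ^ 2 ≤ (∑ i, ‖v i‖) ^ 2 := by gcongr; exact norm_sum_le _ _
    _ ≤ _ := sq_sum_le_card_mul_sum_sq

/-- Cauchy-Schwarz over the sent configuration `k` costs the factor `|α|`, which is exactly the
normalization in `combMat`. -/
theorem IsComb.sum_opMat_combMat_le_one [Nonempty α] {L : A → α → β → β → K →L[ℂ] K}
    (hL : IsComb L) : ∑ a, opMat (combMat L a) ≤ 1 := by
  rw [ContinuousLinearMap.le_def, ContinuousLinearMap.isPositive_iff_complex]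
  intro v
  have h : inner ℂ v ((1 - ∑ a, opMat (combMat L a)) v) = ((‖v‖ ^ 2 - ∑ a,
      (Fintype.card α : ℝ)⁻¹ * ∑ g, ‖∑ k, ∑ h, L a k g h (v (k, h))‖ ^ 2 : ℝ) : ℂ) := by
    rw [sub_apply, inner_sub_right, sum_apply, inner_sum]
    simp only [inner_combMat]
    push_cast
    congr 1
    exact inner_self_eq_norm_sq_to_K (𝕜 := ℂ) v
  have hle : ∑ a, (Fintype.card α : ℝ)⁻¹ * ∑ g, ‖∑ k, ∑ h, L a k g h (v (k, h))‖ ^ 2 ≤ ‖v‖ ^ 2 := by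
    rw [← Finset.mul_sum, inv_mul_le_iff₀ (by exact_mod_cast Fintype.card_pos)]
    calc ∑ a, ∑ g, ‖∑ k, ∑ h, L a k g h (v (k, h))‖ ^ 2
        ≤ ∑ a, ∑ g, Fintype.card α * ∑ k, ‖∑ h, L a k g h (v (k, h))‖ ^ 2 :=
          Finset.sum_le_sum fun a _ => Finset.sum_le_sum fun g _ => norm_sum_sq_le_card_mul _
      _ = Fintype.card α * ∑ k, ∑ a, ∑ g, ‖∑ h, L a k g h (v (k, h))‖ ^ 2 := by
          simp only [← Finset.mul_sum]
          congr 1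
          exact (sum_sum_sum_rotate fun k a g => ‖∑ h, L a k g h (v (k, h))‖ ^ 2).symm
      -- Adding the terms with `k' ≠ k` completes the sum to the one in the isometry identity for `w
      -- = v (k, ·)`.
      _ ≤ Fintype.card α * ∑ k, ∑ a, ∑ k', ∑ g, ‖∑ h, L a k' g h (v (k, h))‖ ^ 2 := by
          gcongr with k _ a _
          exact Finset.single_le_sum (f := fun k' => ∑ g, ‖∑ h, L a k' g h (v (k, h))‖ ^ 2)
            (fun k' _ => by positivity) (Finset.mem_univ k)
      _ = Fintype.card α * ‖v‖ ^ 2 := by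
          rw [PiLp.norm_sq_eq_of_L2, Fintype.sum_prod_type]
          simp only [hL.sum_norm_sq fun h => v (_, h)]
  have h' : inner ℂ ((1 - ∑ a, opMat (combMat L a)) v) v = ((‖v‖ ^ 2 - ∑ a,
      (Fintype.card α : ℝ)⁻¹ * ∑ g, ‖∑ k, ∑ h, L a k g h (v (k, h))‖ ^ 2 : ℝ) : ℂ) := by
    rw [← inner_conj_symm, h, Complex.conj_ofReal]
  rw [h']
  rw [RCLike.re_to_complex, Complex.ofReal_re]
  refine ⟨rfl, ?_⟩
  linarith

/-- The partial trace over both registers; it determines the success probability of one player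
alone. -/
theorem IsComb.sum_combMat_diag {L : A → α → β → β → K →L[ℂ] K} (hL : IsComb L) :
    ∑ a, ∑ r, combMat L a r r = ((Fintype.card α : ℂ)⁻¹ * Fintype.card β) • 1 := by
  simp only [combMat_apply, ← Finset.smul_sum]
  rw [mul_smul]
  congr 1
  calc ∑ a, ∑ r : α × β, ∑ g, star (L a r.1 g r.2) * L a r.1 g r.2
      = ∑ h, ∑ a, ∑ k, ∑ g, star (L a k g h) * L a k g h := by
        simp only [Fintype.sum_prod_type]
        rw [Finset.sum_comm (s := (Finset.univ : Finset β))]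
        exact Finset.sum_congr rfl fun a _ => Finset.sum_comm
    _ = _ := by
        simp only [hL _ _, if_true, Finset.sum_const, Finset.card_univ]
        rw [Nat.cast_smul_eq_nsmul]

end Comb

/-! ### The maximally entangled state of two registers -/

section MaxEntangled

set_option linter.unusedSectionVars false

variable {σ τ H : Type*} [Fintype σ] [Fintype τ] [DecidableEq σ] [DecidableEq τ]
  [NormedAddCommGroup H] [InnerProductSpace ℂ H] [CompleteSpace H]

/-- The unnormalized maximally entangled state of two registers, tensored with `ψ`. -/
def maxEntangled (e : τ ≃ σ) (ψ : H) : DirectSumSpace τ (DirectSumSpace σ H) :=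
  WithLp.toLp 2 fun s => PiLp.single 2 (e s) ψ

theorem norm_maxEntangled_sq (e : τ ≃ σ) (ψ : H) :
    ‖maxEntangled e ψ‖ ^ 2 = Fintype.card τ * ‖ψ‖ ^ 2 := by
  rw [PiLp.norm_sq_eq_of_L2]
  simp [maxEntangled]

/-- The two registers always hold matching configurations, so the operators are paired entry by
entry. This pairing performs the contraction that communication performed in the protocol. -/
theorem inner_maxEntangled (e : τ ≃ σ) (ψ : H) (M : Matrix σ σ (H →L[ℂ] H))
    (N : Matrix τ τ (H →L[ℂ] H)) :
    inner ℂ (maxEntangled e ψ) ((ampliation τ (DirectSumSpace σ H) (opMat M) *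
      opMat (N.map (ampliation σ H))) (maxEntangled e ψ)) =
      ∑ s', ∑ s, inner ℂ ψ ((M (e s') (e s) * N s' s) ψ) := by
  rw [PiLp.inner_apply]
  refine Finset.sum_congr rfl fun s' _ => ?_
  rw [mul_apply_eq_comp, ampliation_apply, opMat_apply, map_sum]
  change inner ℂ (PiLp.single 2 (e s') ψ : DirectSumSpace σ H) _ = _
  rw [inner_single_left, WithLp.ofLp_sum, Finset.sum_apply, inner_sum]
  refine Finset.sum_congr rfl fun s _ => ?_
  have : (N.map (ampliation σ H)) s' s (maxEntangled e ψ s) =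
      (PiLp.single 2 (e s) (N s' s ψ) : DirectSumSpace σ H) := by
    ext i
    rw [Matrix.map_apply, ampliation_apply]
    by_cases h : i = e s
    · subst h; simp [maxEntangled]
    · simp [maxEntangled, h]
  rw [this, opMat_single]
  rfl

end MaxEntangled
end

/-! ### Replacing quantum communication by postselection on a maximally entangled state -/

noncomputable section

section

variable {A B α β H : Type*} [Fintype α] [Fintype β] [NormedAddCommGroup H]
  [InnerProductSpace ℂ H] [CompleteSpace H] {L : A → α → β → β → H →L[ℂ] H}
  {R : B → β → α → α → H →L[ℂ] H} {a : A} {b : B}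

theorem commute_combMat (h : ∀ k g h k' g' h', Commute (L a k g h) (R b k' g' h'))
    (hs : ∀ k g h k' g' h', Commute (star (L a k g h)) (R b k' g' h')) (r r' : α × β)
    (t t' : β × α) : Commute (combMat L a r r') (combMat R b t t') := by
  have h1 : ∀ k g h k' g' h', Commute (star (L a k g h)) (star (R b k' g' h')) :=
    fun k g j k' g' j' => (h k g j k' g' j').star_star
  have h2 : ∀ k g h k' g' h', Commute (L a k g h) (star (R b k' g' h')) :=
    fun k g j k' g' j' => by simpa using (hs k g j k' g' j').star_star
  rw [combMat_apply, combMat_apply]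
  exact Commute.smul_left (Commute.smul_right (Commute.sum_left _ _ _ fun g _ =>
    Commute.sum_right _ _ _ fun g' _ => ((h1 _ _ _ _ _ _).mul_right (hs _ _ _ _ _ _)).mul_left
      ((h2 _ _ _ _ _ _).mul_right (h _ _ _ _ _ _))) _) _

/-- Commutation turns `L* L R* R` into `(L R)* (L R)`. The two sums over matching configurations are
then the bra and the ket of the squared norm. -/
theorem sum_inner_combMat (h : ∀ k g h k' g' h', Commute (L a k g h) (R b k' g' h'))
    (hs : ∀ k g h k' g' h', Commute (star (L a k g h)) (R b k' g' h')) (ψ : H) :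
    ∑ s' : β × α, ∑ s : β × α, inner ℂ ψ ((combMat L a s'.swap s.swap * combMat R b s' s) ψ) =
      ((Fintype.card α : ℂ) * Fintype.card β)⁻¹ *
        ((∑ f, ∑ g, ‖∑ k, ∑ h, (L a k g h * R b h f k) ψ‖ ^ 2 : ℝ) : ℂ) := by
  let V : α → β → β × α → H := fun f g s => (L a s.2 g s.1 * R b s.1 f s.2) ψ
  have hV : ∀ f g s' s, inner ℂ ψ ((star (L a s'.2 g s'.1) * L a s.2 g s.1 *
      (star (R b s'.1 f s'.2) * R b s.1 f s.2)) ψ) = inner ℂ (V f g s') (V f g s) := by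
    intro f g s' s
    have h1 : Commute (star (R b s'.1 f s'.2)) (L a s.2 g s.1) := by
      simpa using (hs s.2 g s.1 s'.1 f s'.2).star_star.symm
    have h2 : Commute (star (R b s'.1 f s'.2)) (star (L a s'.2 g s'.1)) :=
      (h s'.2 g s'.1 s'.1 f s'.2).star_star.symm
    have e : star (L a s'.2 g s'.1) * L a s.2 g s.1 * (star (R b s'.1 f s'.2) * R b s.1 f s.2) =
        star (L a s'.2 g s'.1 * R b s'.1 f s'.2) * (L a s.2 g s.1 * R b s.1 f s.2) := by
      rw [star_mul, h2.eq]
      simp only [mul_assoc]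
      rw [← mul_assoc (L a s.2 g s.1), ← h1.eq, mul_assoc]
    rw [e, mul_apply_eq_comp, ContinuousLinearMap.star_eq_adjoint,
      ContinuousLinearMap.adjoint_inner_right]
  have hnorm : ∀ f g, ((‖∑ k, ∑ h, (L a k g h * R b h f k) ψ‖ ^ 2 : ℝ) : ℂ) =
      ∑ s', ∑ s, inner ℂ (V f g s') (V f g s) := fun f g => by
    have : ∑ k, ∑ h, (L a k g h * R b h f k) ψ = ∑ s, V f g s := by
      rw [Finset.sum_comm, Fintype.sum_prod_type]
    rw [this, Complex.ofReal_pow]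
    refine (inner_self_eq_norm_sq_to_K (𝕜 := ℂ) (∑ s, V f g s)).symm.trans ?_
    rw [sum_inner]
    simp only [inner_sum]
  simp only [Complex.ofReal_sum, hnorm, ← hV]
  rw [(Finset.sum_congr rfl fun f _ => sum_sum_sum_rotate _).trans (sum_sum_sum_rotate _),
    Finset.mul_sum]
  refine Finset.sum_congr rfl fun s' _ => ?_
  rw [Finset.mul_sum]
  refine Finset.sum_congr rfl fun s _ => ?_
  rw [combMat_apply, combMat_apply, smul_mul_smul_comm, Finset.sum_mul_sum, Finset.sum_comm,
    smul_apply, inner_smul_right, ← mul_inv]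
  simp only [sum_apply, inner_sum]
  rfl

end

/-- An entanglement-assisted protocol with `q` qubits is simulated, with success probability
`4 ^ (-q)`, by local generalized measurements with an additional outcome for failure. -/
theorem QuantumSim.exists_subPOVM {X Y A B : Type*} [Fintype A] [Fintype B] {q : ℕ}
    {p : Table X Y A B} (hp : QuantumSim q p) :
    ∃ (H : Type) (_ : NormedAddCommGroup H) (_ : InnerProductSpace ℂ H) (_ : CompleteSpace H)
      (ψ : H) (E : X → A → H →L[ℂ] H) (F : Y → B → H →L[ℂ] H) (d d' : ℝ),
      ‖ψ‖ = 1 ∧ 0 < d ∧ 0 < d' ∧ d * d' = 2 ^ q ∧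
      (∀ x a, 0 ≤ E x a) ∧ (∀ x, ∑ a, E x a ≤ 1) ∧ (∀ y b, 0 ≤ F y b) ∧ (∀ y, ∑ b, F y b ≤ 1) ∧
      (∀ x y a b, Commute (E x a) (F y b)) ∧
      (∀ x y a b, (p x y a b : ℂ) = 4 ^ q * inner ℂ ψ ((E x a * F y b) ψ)) ∧
      (∀ x, ∑ a, inner ℂ ψ (E x a ψ) = (((d ^ 2)⁻¹ : ℝ) : ℂ)) ∧
      (∀ y, ∑ b, inner ℂ ψ (F y b ψ) = (((d' ^ 2)⁻¹ : ℝ) : ℂ)) := by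
  obtain ⟨H, _, _, _, π, hπ⟩ := hp
  obtain ⟨α, β, _, _, _, _, L, R, hcard, hL, hR, hLR, hLR', hprob⟩ := π.exists_comb
  have hne : Fintype.card α ≠ 0 ∧ Fintype.card β ≠ 0 := by
    constructor <;> intro h <;> simp [h] at hcard <;> exact absurd hcard.symm (by positivity)
  have : Nonempty α := Fintype.card_pos_iff.1 (Nat.pos_of_ne_zero hne.1)
  have : Nonempty β := Fintype.card_pos_iff.1 (Nat.pos_of_ne_zero hne.2)
  let e : β × α ≃ α × β := Equiv.prodComm β α
  have hcardR : (Fintype.card α : ℝ) * Fintype.card β = 2 ^ q := by exact_mod_cast hcard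
  have hcardC : (Fintype.card α : ℂ) * Fintype.card β = 2 ^ q := by exact_mod_cast hcard
  have hαC : (Fintype.card α : ℂ) ≠ 0 := by exact_mod_cast hne.1
  have hβC : (Fintype.card β : ℂ) ≠ 0 := by exact_mod_cast hne.2
  let R' : Y → B → β → α → α → DirectSumSpace (α × β) H →L[ℂ] DirectSumSpace (α × β) H :=
    fun y b h f k => ampliation (α × β) H (R y b h f k)
  have hR' : ∀ y, IsComb (R' y) := fun y => (hR y).map _
  have hRmap : ∀ y b, combMat (R' y) b = (combMat (R y) b).map (ampliation (α × β) H) := by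
    intro y b
    ext1 r' r
    rw [Matrix.map_apply, combMat_apply, combMat_apply, map_smul, map_sum]
    simp only [map_mul, map_star, R']
  -- The maximally entangled vector has squared norm `|α| |β| = 2 ^ q`.
  let s : ℝ := (Real.sqrt (2 ^ q))⁻¹
  have hs0 : 0 ≤ s := inv_nonneg.2 (Real.sqrt_nonneg _)
  have hs2 : s ^ 2 = (2 ^ q)⁻¹ := by
    rw [inv_pow, Real.sq_sqrt (by positivity)]
  have hs2C : (s : ℂ) * s = (2 ^ q)⁻¹ := by
    rw [← sq, ← Complex.ofReal_pow, hs2]; push_cast; rfl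
  let Ψ : DirectSumSpace (β × α) (DirectSumSpace (α × β) H) := (s : ℂ) • maxEntangled e π.ψ
  have hΨ : ∀ (M : Matrix (α × β) (α × β) (H →L[ℂ] H)) (N : Matrix (β × α) (β × α) (H →L[ℂ] H)),
      inner ℂ Ψ ((ampliation (β × α) (DirectSumSpace (α × β) H) (opMat M) *
        opMat (N.map (ampliation (α × β) H))) Ψ) =
      (2 ^ q)⁻¹ * ∑ s', ∑ s, inner ℂ π.ψ ((M (e s') (e s) * N s' s) π.ψ) := fun M N => by
    rw [map_smul, inner_smul_left, inner_smul_right, inner_maxEntangled, Complex.conj_ofReal,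
      ← mul_assoc, hs2C]
  have hone : ∀ n K : Type, ∀ [Fintype n] [DecidableEq n] [NormedAddCommGroup K]
      [InnerProductSpace ℂ K] [CompleteSpace K], opMat (1 : Matrix n n (K →L[ℂ] K)) = 1 :=
    fun n K => map_one (opMatHom n K)
  have hmapone : (1 : Matrix (β × α) (β × α) (H →L[ℂ] H)).map (ampliation (α × β) H) = 1 :=
    Matrix.map_one _ (map_zero _) (map_one _)
  refine ⟨DirectSumSpace (β × α) (DirectSumSpace (α × β) H), inferInstance, inferInstance,
    inferInstance, Ψ, fun x a => ampliation (β × α) (DirectSumSpace (α × β) H) (opMat (combMat (L x) a)),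
    fun y b => opMat (combMat (R' y) b), Fintype.card α, Fintype.card β, ?_,
    by positivity, by positivity, hcardR, fun x a => map_nonneg _ (opMat_combMat_nonneg _ _),
    fun x => ?_, fun y b => opMat_combMat_nonneg _ _, fun y => (hR' y).sum_opMat_combMat_le_one,
    fun x y a b => ?_, fun x y a b => ?_, fun x => ?_, fun y => ?_⟩
  · have h1 : ‖Ψ‖ ^ 2 = 1 := by
      rw [norm_smul, mul_pow, norm_maxEntangled_sq, π.norm_ψ, Complex.norm_real,
        Real.norm_of_nonneg hs0, hs2, Fintype.card_prod, Nat.cast_mul,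
        mul_comm (Fintype.card β : ℝ), hcardR]
      field_simp
    exact (pow_eq_one_iff_of_nonneg (norm_nonneg _) two_ne_zero).1 h1
  · rw [← map_sum, ← map_one (ampliation (β × α) (DirectSumSpace (α × β) H))]
    exact OrderHomClass.mono _ (hL x).sum_opMat_combMat_le_one
  · refine commute_ampliation_opMat fun i j => ?_
    rw [hRmap, Matrix.map_apply]
    refine (commute_ampliation_opMat fun r' r => ?_).symm
    exact (commute_combMat (hLR x y a b) (hLR' x y a b) _ _ _ _).symm
  -- One factor `2 ^ (-q)` comes from the state and one from the normalizations of the two combs: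
  -- together `4 ^ (-q)`.
  · have h := sum_inner_combMat (hLR x y a b) (hLR' x y a b) π.ψ
    rw [← hprob, ← hπ, hcardC] at h
    beta_reduce
    rw [hRmap, hΨ]
    change _ = 4 ^ q * ((2 ^ q)⁻¹ * ∑ s' : β × α, ∑ s : β × α,
      inner ℂ π.ψ ((combMat (L x) a s'.swap s.swap * combMat (R y) b s' s) π.ψ))
    rw [h, show (4 : ℂ) = 2 * 2 by norm_num, mul_pow]
    field_simp
  -- With Bob's operator equal to `1`, only the diagonal remains, and the total is `2 ^ (-q) |β| /
  -- |α| = 1 / |α| ^ 2`.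
  · have h : ∀ a, inner ℂ Ψ (ampliation (β × α) (DirectSumSpace (α × β) H)
        (opMat (combMat (L x) a)) Ψ) =
        (2 ^ q)⁻¹ * ∑ r, inner ℂ π.ψ (combMat (L x) a r r π.ψ) := fun a => by
      have := hΨ (combMat (L x) a) 1
      rw [hmapone, hone, mul_one] at this
      rw [this, ← Equiv.sum_comp e]
      congr 1
      refine Finset.sum_congr rfl fun s' _ => ?_
      rw [Finset.sum_eq_single s']
      · simp
      · intro t _ ht; simp [Matrix.one_apply_ne ht.symm]
      · simp
    simp only [h]
    rw [← Finset.mul_sum]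
    have := congrArg (fun T : H →L[ℂ] H => inner ℂ π.ψ (T π.ψ)) (hL x).sum_combMat_diag
    simp only [sum_apply, inner_sum, smul_apply, inner_smul_right, one_apply_eq_self,
      inner_self_eq_norm_sq_to_K, π.norm_ψ] at this
    rw [this, ← hcardC]
    push_cast
    field_simp
  · have h : ∀ b, inner ℂ Ψ (opMat (combMat (R' y) b) Ψ) =
        (2 ^ q)⁻¹ * ∑ r, inner ℂ π.ψ (combMat (R y) b r r π.ψ) := fun b => by
      have := hΨ 1 (combMat (R y) b)
      rw [hone, map_one, one_mul, ← hRmap] at this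
      rw [this]
      congr 1
      refine Finset.sum_congr rfl fun s' _ => ?_
      rw [Finset.sum_eq_single s']
      · simp
      · intro t _ ht; simp [Matrix.one_apply_ne (e.injective.ne ht.symm)]
      · simp
    simp only [h]
    rw [← Finset.mul_sum]
    have := congrArg (fun T : H →L[ℂ] H => inner ℂ π.ψ (T π.ψ)) (hR y).sum_combMat_diag
    simp only [sum_apply, inner_sum, smul_apply, inner_smul_right, one_apply_eq_self,
      inner_self_eq_norm_sq_to_K, π.norm_ψ] at this
    rw [this, ← hcardC]
    push_cast
    field_simp

end

noncomputable section

/-! ### Tables of commuting generalized measurements -/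

section POVM

set_option linter.unusedSectionVars false

open scoped ComplexOrder

variable {X Y A B H : Type*} [NormedAddCommGroup H] [InnerProductSpace ℂ H] [CompleteSpace H]

/-- The real parts of the expectations of the products `E x a * F y b`. -/
def povmTable (ψ : H) (E : X → A → H →L[ℂ] H) (F : Y → B → H →L[ℂ] H) : Table X Y A B :=
  fun x y a b => (inner ℂ ψ ((E x a * F y b) ψ)).re

theorem inner_mul_nonneg {S T : H →L[ℂ] H} (hS : 0 ≤ S) (hT : 0 ≤ T) (h : Commute S T) (ψ : H) :
    0 ≤ inner ℂ ψ ((S * T) ψ) := by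
  have : 0 ≤ S * T := Commute.mul_nonneg hS hT h
  exact ((ContinuousLinearMap.nonneg_iff_isPositive _).1 this).inner_nonneg_right ψ

theorem ofReal_povmTable {E : X → A → H →L[ℂ] H} {F : Y → B → H →L[ℂ] H} (ψ : H)
    (hE : ∀ x a, 0 ≤ E x a) (hF : ∀ y b, 0 ≤ F y b) (h : ∀ x y a b, Commute (E x a) (F y b))
    (x : X) (y : Y) (a : A) (b : B) :
    (povmTable ψ E F x y a b : ℂ) = inner ℂ ψ ((E x a * F y b) ψ) := by
  have := inner_mul_nonneg (hE x a) (hF y b) (h x y a b) ψ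
  rw [Complex.nonneg_iff] at this
  exact Complex.ext rfl (by simpa using this.2)

theorem nonSignaling_povmTable [Fintype A] [Fintype B] {E : X → A → H →L[ℂ] H}
    {F : Y → B → H →L[ℂ] H} {ψ : H} (hψ : ‖ψ‖ = 1) (hE : ∀ x a, 0 ≤ E x a)
    (hE1 : ∀ x, ∑ a, E x a = 1) (hF : ∀ y b, 0 ≤ F y b) (hF1 : ∀ y, ∑ b, F y b = 1)
    (h : ∀ x y a b, Commute (E x a) (F y b)) : NonSignaling (povmTable ψ E F) := by
  have hb : ∀ x y a, ∑ b, povmTable ψ E F x y a b = (inner ℂ ψ (E x a ψ)).re := fun x y a => by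
    simp only [povmTable]
    rw [← Complex.re_sum, ← inner_sum, ← sum_apply, ← Finset.mul_sum, hF1, mul_one]
  have ha : ∀ x y b, ∑ a, povmTable ψ E F x y a b = (inner ℂ ψ (F y b ψ)).re := fun x y b => by
    simp only [povmTable]
    rw [← Complex.re_sum, ← inner_sum, ← sum_apply, ← Finset.sum_mul, hE1, one_mul]
  refine ⟨fun x y a b => ?_, fun x y => ?_, fun a x y y' => ?_, fun b x x' y => ?_⟩
  · exact (Complex.nonneg_iff.1 (inner_mul_nonneg (hE x a) (hF y b) (h x y a b) ψ)).1
  · simp only [hb]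
    rw [← Complex.re_sum, ← inner_sum, ← sum_apply, hE1, one_apply_eq_self,
      inner_self_eq_norm_sq_to_K, hψ]
    simp
  · rw [hb, hb]
  · rw [ha, ha]

/-- The completion of a family of positive operators by the outcome `none`. -/
def completePOVM [Fintype A] (E : X → A → H →L[ℂ] H) (x : X) : Option A → H →L[ℂ] H
  | some a => E x a
  | none => 1 - ∑ a, E x a

theorem completePOVM_nonneg [Fintype A] {E : X → A → H →L[ℂ] H} (hE : ∀ x a, 0 ≤ E x a)
    (hE1 : ∀ x, ∑ a, E x a ≤ 1) (x : X) : ∀ a, 0 ≤ completePOVM E x a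
  | some a => hE x a
  | none => sub_nonneg.2 (hE1 x)

theorem sum_completePOVM [Fintype A] (E : X → A → H →L[ℂ] H) (x : X) :
    ∑ a, completePOVM E x a = 1 := by
  rw [Fintype.sum_option]
  simp [completePOVM]

theorem commute_completePOVM [Fintype A] {E : X → A → H →L[ℂ] H} {T : H →L[ℂ] H}
    (h : ∀ x a, Commute (E x a) T) (x : X) : ∀ a, Commute (completePOVM E x a) T
  | some a => h x a
  | none => (Commute.one_left T).sub_left (Commute.sum_left _ _ _ fun a _ => h x a)

/-- Replacing the outcome `none` by a sample of `s`. -/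
def fillPOVM (s : X → A → ℝ) (E : X → Option A → H →L[ℂ] H) (x : X) (a : A) : H →L[ℂ] H :=
  E x (some a) + (s x a : ℂ) • E x none

theorem fillPOVM_nonneg [Fintype A] {s : X → A → ℝ} (hs : IsDist s)
    {E : X → Option A → H →L[ℂ] H} (hE : ∀ x a, 0 ≤ E x a) (x : X) (a : A) :
    0 ≤ fillPOVM s E x a := by
  refine add_nonneg (hE _ _) ?_
  have h := (ContinuousLinearMap.nonneg_iff_isPositive _).1 (hE x none)
  exact (ContinuousLinearMap.nonneg_iff_isPositive _).2
    (h.smul_of_nonneg (by exact_mod_cast hs.nonneg x a))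

theorem sum_fillPOVM [Fintype A] {s : X → A → ℝ} (hs : IsDist s)
    {E : X → Option A → H →L[ℂ] H} (hE : ∀ x, ∑ a, E x a = 1) (x : X) :
    ∑ a, fillPOVM s E x a = 1 := by
  simp only [fillPOVM]
  rw [Finset.sum_add_distrib, ← Finset.sum_smul, ← Complex.ofReal_sum, hs.sum_eq_one,
    Complex.ofReal_one, one_smul, add_comm, ← Fintype.sum_option, hE]

theorem commute_fillPOVM {s : X → A → ℝ} {E : X → Option A → H →L[ℂ] H} {T : H →L[ℂ] H}
    (h : ∀ x a, Commute (E x a) T) (x : X) (a : A) : Commute (fillPOVM s E x a) T :=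
  (h x _).add_left ((h x _).smul_left _)

theorem fillTable_povmTable (s : X → A → ℝ) (t : Y → B → ℝ) (ψ : H)
    (E : X → Option A → H →L[ℂ] H) (F : Y → Option B → H →L[ℂ] H) :
    fillTable s t (povmTable ψ E F) = povmTable ψ (fillPOVM s E) (fillPOVM t F) := by
  ext x y a b
  have e : fillPOVM s E x a * fillPOVM t F y b = E x (some a) * F y (some b) +
      (t y b : ℂ) • (E x (some a) * F y none) + (s x a : ℂ) • (E x none * F y (some b)) +
      ((s x a * t y b : ℝ) : ℂ) • (E x none * F y none) := by
    simp only [fillPOVM, add_mul, mul_add, smul_mul_assoc, mul_smul_comm]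
    push_cast
    module
  simp only [fillTable, povmTable, e, add_apply, smul_apply, inner_add_right, inner_smul_right,
    Complex.add_re, Complex.re_ofReal_mul]
  ring

end POVM

theorem povmTable_mem_quantumSet {X Y A B : Type*} {H : Type} [NormedAddCommGroup H]
    [InnerProductSpace ℂ H] [CompleteSpace H] [Fintype A] [Fintype B] [Nonempty A] [Nonempty B]
    {ψ : H} (hψ : ‖ψ‖ = 1) {E : X → A → H →L[ℂ] H} {F : Y → B → H →L[ℂ] H}
    (hE : ∀ x a, 0 ≤ E x a) (hE1 : ∀ x, ∑ a, E x a = 1)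
    (hF : ∀ y b, 0 ≤ F y b) (hF1 : ∀ y, ∑ b, F y b = 1)
    (hcomm : ∀ x y a b, Commute (E x a) (F y b)) :
    povmTable ψ E F ∈ quantumSet X Y A B :=
  mem_quantumSet_of_povm hψ hE hE1 hF hF1 hcomm (ofReal_povmTable ψ hE hF hcomm)

theorem IsDist.nonempty {X A : Type*} [Fintype A] [Nonempty X] {s : X → A → ℝ} (hs : IsDist s) :
    Nonempty A := by
  by_contra h
  rw [not_nonempty_iff] at h
  simpa using hs.sum_eq_one (Classical.arbitrary X)

/-- Scalar measurements on the one-dimensional space `ℂ`; the dilation makes them projective. -/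
theorem prodTable_mem_quantumSet {X Y A B : Type*} [Fintype A] [Fintype B] [Nonempty X]
    [Nonempty Y] {s : X → A → ℝ} {t : Y → B → ℝ} (hs : IsDist s) (ht : IsDist t) :
    prodTable s t ∈ quantumSet X Y A B := by
  have := hs.nonempty
  have := ht.nonempty
  have dist : ∀ (c : ℝ), 0 ≤ c → 0 ≤ (c : ℂ) • (1 : ℂ →L[ℂ] ℂ) := fun c hc =>
    (ContinuousLinearMap.nonneg_iff_isPositive _).2
      (ContinuousLinearMap.isPositive_one.smul_of_nonneg (Complex.zero_le_real.2 hc))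
  refine mem_quantumSet_of_povm (H := ℂ) (ψ := 1) (by simp)
    (E := fun x a => (s x a : ℂ) • (1 : ℂ →L[ℂ] ℂ)) (F := fun y b => (t y b : ℂ) • (1 : ℂ →L[ℂ] ℂ))
    (fun x a => dist _ (hs.nonneg x a)) (fun x => ?_) (fun y b => dist _ (ht.nonneg y b))
    (fun y => ?_) (fun x y a b => ?_) fun x y a b => ?_
  · rw [← Finset.sum_smul, ← Complex.ofReal_sum, hs.sum_eq_one, Complex.ofReal_one, one_smul]
  · rw [← Finset.sum_smul, ← Complex.ofReal_sum, ht.sum_eq_one, Complex.ofReal_one, one_smul]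
  · exact ((Commute.one_left _).smul_left _).smul_right _
  · simp [prodTable, mul_comm]

/-- The subnormalized measurements are completed by a failure outcome, and postselection is applied
with `N = 4 ^ q`. -/
theorem gammaTilde_le_of_quantumSim {X Y A B : Type*} [Finite X] [Nonempty X] [Nonempty Y]
    [Fintype A] [Fintype B] {q : ℕ} {p : Table X Y A B} (hp : NonSignaling p)
    (h : QuantumSim q p) : gammaTilde p ≤ 2 * 4 ^ q - 1 := by
  obtain ⟨H, _, _, _, ψ, E, F, -, -, hψ, -, -, -, hE, hE1, hF, hF1, hc, hpv, -, -⟩ :=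
    h.exists_subPOVM
  have hc' : ∀ x y a b, Commute (completePOVM E x a) (completePOVM F y b) := fun x y a b =>
    commute_completePOVM (fun x a => (commute_completePOVM (fun y b => (hc x y a b).symm) y b).symm)
      x a
  have hE0 := completePOVM_nonneg hE hE1
  have hF0 := completePOVM_nonneg hF hF1
  refine affineCost_le_of_postselection hp (nonSignaling_povmTable hψ hE0 (sum_completePOVM E)
    hF0 (sum_completePOVM F) hc') (one_le_pow₀ (by norm_num)) (fun x y a b => ?_)
    (fun s t hs ht => prodTable_mem_quantumSet hs ht) fun s t hs ht => ?_
  · have h1 := ofReal_povmTable ψ hE0 hF0 hc' x y (some a) (some b)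
    have h2 := hpv x y a b
    change _ = inner ℂ ψ ((E x a * F y b) ψ) at h1
    rw [← h1] at h2
    exact_mod_cast h2.symm
  · have := hs.nonempty
    have := ht.nonempty
    rw [fillTable_povmTable]
    exact povmTable_mem_quantumSet hψ (fillPOVM_nonneg hs hE0) (sum_fillPOVM hs (sum_completePOVM E))
      (fillPOVM_nonneg ht hF0) (sum_fillPOVM ht (sum_completePOVM F)) fun x y a b =>
        commute_fillPOVM (fun x a => (commute_fillPOVM (fun y b => (hc' x y a b).symm) y b).symm) x a

end

noncomputable section

/-! ### Anticommuting matrices and quantum correlations -/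

-- Clifford generators, built by adjoining one qubit at a time: `1 ⊗ σz` anticommutes with every `γ
-- i ⊗ σx`. Vanishing traces later give uniform marginals.
open scoped Kronecker in
theorem exists_anticommuting_matrices (n : ℕ) :
    ∃ (d : Type) (_ : Fintype d) (_ : DecidableEq d) (_ : Nonempty d) (γ : Fin n → Matrix d d ℂ),
      (∀ i, star (γ i) = γ i) ∧ (∀ i, (γ i).trace = 0) ∧
      ∀ i j, γ i * γ j + γ j * γ i = if i = j then 2 else 0 := by
  induction n with
  | zero => exact ⟨Unit, inferInstance, inferInstance, inferInstance, fun i => i.elim0,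
      fun i => i.elim0, fun i => i.elim0, fun i => i.elim0⟩
  | succ n ih =>
    obtain ⟨d, _, _, _, γ, hs, ht, hc⟩ := ih
    let σz : Matrix (Fin 2) (Fin 2) ℂ := !![1, 0; 0, -1]
    let σx : Matrix (Fin 2) (Fin 2) ℂ := !![0, 1; 1, 0]
    have hzs : σz.conjTranspose = σz := by
      ext i j; fin_cases i <;> fin_cases j <;> simp [σz]
    have hxs : σx.conjTranspose = σx := by
      ext i j; fin_cases i <;> fin_cases j <;> simp [σx]
    have hzz : σz * σz = 1 := by
      ext i j; fin_cases i <;> fin_cases j <;> simp [σz]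
    have hxx : σx * σx = 1 := by
      ext i j; fin_cases i <;> fin_cases j <;> simp [σx]
    have hzx : σz * σx + σx * σz = 0 := by
      ext i j; fin_cases i <;> fin_cases j <;> simp [σz, σx]
    have hzt : σz.trace = 0 := by simp [σz, Matrix.trace_fin_two]
    have hxt : σx.trace = 0 := by simp [σx, Matrix.trace_fin_two]
    refine ⟨d × Fin 2, inferInstance, inferInstance, inferInstance,
      Fin.cons (1 ⊗ₖ σz) fun i => γ i ⊗ₖ σx, fun i => ?_, fun i => ?_, fun i j => ?_⟩
    · refine Fin.cases ?_ (fun i => ?_) i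
      · simp [Matrix.star_eq_conjTranspose, Matrix.conjTranspose_kronecker, hzs]
      · have := hs i
        rw [Matrix.star_eq_conjTranspose] at this
        simp [Matrix.star_eq_conjTranspose, Matrix.conjTranspose_kronecker, hxs, this]
    · refine Fin.cases ?_ (fun i => ?_) i
      · simp [Matrix.trace_kronecker, hzt]
      · simp [Matrix.trace_kronecker, hxt]
    · refine Fin.cases ?_ (fun i => ?_) i <;> refine Fin.cases ?_ (fun j => ?_) j
      · simp [← Matrix.mul_kronecker_mul, hzz, one_add_one_eq_two]
      · simp only [Fin.cons_zero, Fin.cons_succ, ← Matrix.mul_kronecker_mul, one_mul, mul_one,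
          ← Matrix.kronecker_add, hzx, Matrix.kronecker_zero, (Fin.succ_ne_zero _).symm, if_false]
      · simp only [Fin.cons_zero, Fin.cons_succ, ← Matrix.mul_kronecker_mul, one_mul, mul_one,
          ← Matrix.kronecker_add, add_comm (σx * σz), hzx, Matrix.kronecker_zero,
          Fin.succ_ne_zero, if_false]
      · simp only [Fin.cons_succ, ← Matrix.mul_kronecker_mul, hxx, ← Matrix.add_kronecker, hc,
          Fin.succ_inj]
        split_ifs
        · rw [show (2 : Matrix d d ℂ) = 1 + 1 from one_add_one_eq_two.symm, Matrix.add_kronecker,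
            Matrix.one_kronecker_one, one_add_one_eq_two]
        · simp

theorem isProjMeas_of_involution {R : Type*} [Ring R] [StarRing R] [Algebra ℂ R] [StarModule ℂ R]
    {T : R} (hs : star T = T) (h2 : T * T = 1) :
    IsProjMeas fun a : ℤˣ => (1 / 2 : ℂ) • (1 + ((a : ℤ) : ℂ) • T) where
  selfAdjoint a := by simp [hs]
  mul_eq a a' := by
    have : ((1 / 2 : ℂ) • (1 + ((a : ℤ) : ℂ) • T)) * ((1 / 2 : ℂ) • (1 + ((a' : ℤ) : ℂ) • T)) =
        ((1 + ((a : ℤ) : ℂ) * ((a' : ℤ) : ℂ)) / 4) • (1 : R) +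
          ((((a : ℤ) : ℂ) + ((a' : ℤ) : ℂ)) / 4) • T := by
      simp only [smul_mul_smul_comm, add_mul, mul_add, one_mul, mul_one, h2]
      module
    rw [this]
    rcases Int.units_eq_one_or a with rfl | rfl <;> rcases Int.units_eq_one_or a' with rfl | rfl <;>
      simp <;> module
  sum_eq_one := by
    rw [show (Finset.univ : Finset ℤˣ) = {1, -1} from rfl, Finset.sum_pair (by decide)]
    simp only [Units.val_one, Units.val_neg, Int.cast_one, Int.cast_neg]
    module

theorem uniformMarginals_mem_quantumSet {X Y : Type*} {H : Type} [NormedAddCommGroup H]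
    [InnerProductSpace ℂ H] [CompleteSpace H] {ψ : H} (hψ : ‖ψ‖ = 1) {S : X → H →L[ℂ] H}
    {T : Y → H →L[ℂ] H} (hS : ∀ x, star (S x) = S x) (hS2 : ∀ x, S x * S x = 1)
    (hT : ∀ y, star (T y) = T y) (hT2 : ∀ y, T y * T y = 1) (hc : ∀ x y, Commute (S x) (T y))
    (hS0 : ∀ x, inner ℂ ψ (S x ψ) = 0) (hT0 : ∀ y, inner ℂ ψ (T y ψ) = 0) {c : X → Y → ℝ}
    (hST : ∀ x y, inner ℂ ψ ((S x * T y) ψ) = c x y) :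
    uniformMarginals c ∈ quantumSet X Y ℤˣ ℤˣ := by
  refine ⟨H, inferInstance, inferInstance, inferInstance, ψ,
    fun x a => (1 / 2 : ℂ) • (1 + ((a : ℤ) : ℂ) • S x),
    fun y b => (1 / 2 : ℂ) • (1 + ((b : ℤ) : ℂ) • T y), hψ,
    fun x => isProjMeas_of_involution (hS x) (hS2 x),
    fun y => isProjMeas_of_involution (hT y) (hT2 y), fun x y a b => ?_, fun x y a b => ?_⟩
  · have h1 : Commute (1 + ((a : ℤ) : ℂ) • S x) (1 + ((b : ℤ) : ℂ) • T y) :=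
      (Commute.one_left _).add_left ((Commute.one_right _).add_right
        (((hc x y).smul_left _).smul_right _))
    exact (h1.smul_left _).smul_right _
  · have e : ((1 / 2 : ℂ) • (1 + ((a : ℤ) : ℂ) • S x)) * ((1 / 2 : ℂ) • (1 + ((b : ℤ) : ℂ) • T y)) =
        (1 / 4 : ℂ) • (1 + ((a : ℤ) : ℂ) • S x + ((b : ℤ) : ℂ) • T y +
          (((a : ℤ) : ℂ) * ((b : ℤ) : ℂ)) • (S x * T y)) := by
      simp only [smul_mul_smul_comm, add_mul, mul_add, one_mul, mul_one]
      module
    rw [e]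
    simp only [smul_apply, add_apply, inner_smul_right, inner_add_right, one_apply_eq_self, hS0, hT0,
      hST, inner_self_eq_norm_sq_to_K, hψ, uniformMarginals]
    push_cast
    ring

section Tsirelson

set_option linter.unusedSectionVars false

variable {d : Type} [Fintype d] [DecidableEq d]

/-- The normalized maximally entangled vector. -/
def bellVector (d : Type) [Fintype d] [DecidableEq d] : EuclideanSpace ℂ (d × d) :=
  WithLp.toLp 2 fun r => if r.1 = r.2 then ((Real.sqrt (Fintype.card d))⁻¹ : ℝ) else 0

-- The Bell vector turns local operators into a normalized trace, with a transpose on the second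
-- factor.
open scoped Kronecker in
theorem inner_bellVector (P Q : Matrix d d ℂ) :
    inner ℂ (bellVector d) (Matrix.toEuclideanCLM (𝕜 := ℂ) (P ⊗ₖ Q) (bellVector d)) =
      (Fintype.card d : ℂ)⁻¹ * (P * Q.transpose).trace := by
  have hd : ((Real.sqrt (Fintype.card d))⁻¹ : ℂ) * (Real.sqrt (Fintype.card d) : ℂ)⁻¹ =
      (Fintype.card d : ℂ)⁻¹ := by
    rw [← mul_inv, ← Complex.ofReal_mul, Real.mul_self_sqrt (Nat.cast_nonneg _)]
    simp
  rw [PiLp.inner_apply, Fintype.sum_prod_type]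
  simp only [Matrix.ofLp_toEuclideanCLM, bellVector, Matrix.mulVec, dotProduct,
    Fintype.sum_prod_type, Matrix.kroneckerMap_apply]
  simp only [RCLike.inner_apply, apply_ite (starRingEnd ℂ), mul_ite, map_zero, mul_zero,
    Finset.sum_ite_eq, Finset.mem_univ, if_true, Complex.conj_ofReal, Matrix.trace,
    Matrix.diag_apply, Matrix.mul_apply, Matrix.transpose_apply, Finset.mul_sum, Finset.sum_mul,
    ← hd]
  refine Finset.sum_congr rfl fun i _ => Finset.sum_congr rfl fun j _ => ?_
  push_cast
  ring

theorem norm_bellVector [Nonempty d] : ‖bellVector d‖ = 1 := by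
  have h := inner_bellVector (1 : Matrix d d ℂ) 1
  rw [Matrix.one_kronecker_one, map_one, one_apply_eq_self, inner_self_eq_norm_sq_to_K] at h
  simp only [Matrix.transpose_one, mul_one, Matrix.trace_one] at h
  rw [inv_mul_cancel₀ (by simp)] at h
  have h0 : ((‖bellVector d‖ ^ 2 : ℝ) : ℂ) = 1 := by rw [Complex.ofReal_pow]; exact h
  have h' : ‖bellVector d‖ ^ 2 = 1 := by exact_mod_cast h0
  exact (pow_eq_one_iff_of_nonneg (norm_nonneg _) two_ne_zero).1 h'

/-- The combination of matrices with given real coefficients. -/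
def realCombination {n : ℕ} (γ : Fin n → Matrix d d ℂ) (u : Fin n → ℝ) : Matrix d d ℂ :=
  ∑ i, (u i : ℂ) • γ i

variable {n : ℕ} {γ : Fin n → Matrix d d ℂ}

theorem star_realCombination (hs : ∀ i, star (γ i) = γ i) (u : Fin n → ℝ) :
    star (realCombination γ u) = realCombination γ u := by
  simp only [realCombination, star_sum, star_smul, hs]
  simp

theorem trace_realCombination (ht : ∀ i, (γ i).trace = 0) (u : Fin n → ℝ) :
    (realCombination γ u).trace = 0 := by
  simp [realCombination, Matrix.trace_sum, Matrix.trace_smul, ht]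

theorem realCombination_mul_add
    (hc : ∀ i j, γ i * γ j + γ j * γ i = if i = j then 2 else 0) (u v : Fin n → ℝ) :
    realCombination γ u * realCombination γ v + realCombination γ v * realCombination γ u =
      ((2 * ∑ i, u i * v i : ℝ) : ℂ) • 1 := by
  have e1 : realCombination γ u * realCombination γ v =
      ∑ i, ∑ j, ((u i : ℂ) * v j) • (γ i * γ j) := by
    simp only [realCombination, Finset.sum_mul_sum, smul_mul_smul_comm]
  have e2 : realCombination γ v * realCombination γ u =
      ∑ i, ∑ j, ((u i : ℂ) * v j) • (γ j * γ i) := by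
    simp only [realCombination, Finset.sum_mul_sum, smul_mul_smul_comm]
    rw [Finset.sum_comm]
    simp only [mul_comm (u _ : ℂ)]
  rw [e1, e2, ← Finset.sum_add_distrib]
  simp only [← Finset.sum_add_distrib, ← smul_add, hc]
  simp only [smul_ite, smul_zero, Finset.sum_ite_eq, Finset.mem_univ, if_true]
  rw [← Finset.sum_smul, ← one_add_one_eq_two, smul_add, ← two_smul ℂ, smul_smul]
  push_cast
  rfl

theorem realCombination_sq
    (hc : ∀ i j, γ i * γ j + γ j * γ i = if i = j then 2 else 0) {u : Fin n → ℝ}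
    (hu : ∑ i, u i ^ 2 = 1) : realCombination γ u * realCombination γ u = 1 := by
  have h := realCombination_mul_add hc u u
  simp only [← sq, hu] at h
  rw [← two_smul ℂ, sq] at h
  have h2 := congrArg (fun M => (2⁻¹ : ℂ) • M) h
  simpa [smul_smul] using h2

theorem trace_realCombination_mul
    (hc : ∀ i j, γ i * γ j + γ j * γ i = if i = j then 2 else 0) (u v : Fin n → ℝ) :
    (realCombination γ u * realCombination γ v).trace =
      Fintype.card d * ((∑ i, u i * v i : ℝ) : ℂ) := by
  have h := congrArg Matrix.trace (realCombination_mul_add hc u v)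
  rw [Matrix.trace_add, Matrix.trace_mul_comm (realCombination γ v), Matrix.trace_smul,
    Matrix.trace_one] at h
  push_cast at h ⊢
  simp only [smul_eq_mul] at h
  linear_combination h / 2

open scoped Kronecker in
/-- Inner products of real unit vectors are quantum correlations with uniform marginals. -/
theorem uniformMarginals_mem_quantumSet_of_unit {X Y : Type*} {n : ℕ} {u : X → Fin n → ℝ}
    {v : Y → Fin n → ℝ} (hu : ∀ x, ∑ i, u x i ^ 2 = 1) (hv : ∀ y, ∑ i, v y i ^ 2 = 1)
    {c : X → Y → ℝ} (hc : ∀ x y, c x y = ∑ i, u x i * v y i) :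
    uniformMarginals c ∈ quantumSet X Y ℤˣ ℤˣ := by
  obtain ⟨d, _, _, _, γ, hs, ht, hγ⟩ := exists_anticommuting_matrices n
  let Φ := Matrix.toEuclideanCLM (𝕜 := ℂ) (n := d × d)
  have hstar : ∀ w, (realCombination γ w).conjTranspose = realCombination γ w :=
    star_realCombination hs
  have hstarT : ∀ w, (realCombination γ w).transpose.conjTranspose =
      (realCombination γ w).transpose := fun w => congrArg Matrix.transpose (hstar w)
  have hcard : (Fintype.card d : ℂ) ≠ 0 := by simp
  -- Bob's transpose cancels the one in `inner_bellVector`. Unit vectors give involutions, and the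
  -- anticommutation relations make the normalized trace of a product equal to the inner product.
  refine uniformMarginals_mem_quantumSet (ψ := bellVector d) norm_bellVector
    (S := fun x => Φ (realCombination γ (u x) ⊗ₖ 1))
    (T := fun y => Φ (1 ⊗ₖ (realCombination γ (v y)).transpose)) (fun x => ?_) (fun x => ?_)
    (fun y => ?_) (fun y => ?_) (fun x y => ?_) (fun x => ?_) (fun y => ?_) (fun x y => ?_)
  · rw [← map_star, Matrix.star_eq_conjTranspose, Matrix.conjTranspose_kronecker, hstar,
      Matrix.conjTranspose_one]
  · rw [← map_mul, ← Matrix.mul_kronecker_mul, realCombination_sq hγ (hu x), one_mul,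
      Matrix.one_kronecker_one, map_one]
  · rw [← map_star, Matrix.star_eq_conjTranspose, Matrix.conjTranspose_kronecker,
      Matrix.conjTranspose_one, hstarT]
  · rw [← map_mul, ← Matrix.mul_kronecker_mul, ← Matrix.transpose_mul,
      realCombination_sq hγ (hv y), Matrix.transpose_one, one_mul, Matrix.one_kronecker_one, map_one]
  · rw [Commute, SemiconjBy, ← map_mul, ← map_mul, ← Matrix.mul_kronecker_mul,
      ← Matrix.mul_kronecker_mul]
    simp only [one_mul, mul_one]
  · rw [inner_bellVector, Matrix.transpose_one, mul_one, trace_realCombination ht, mul_zero]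
  · rw [inner_bellVector, Matrix.transpose_transpose, one_mul, trace_realCombination ht, mul_zero]
  · rw [← map_mul, ← Matrix.mul_kronecker_mul, one_mul, mul_one, inner_bellVector,
      Matrix.transpose_transpose, trace_realCombination_mul hγ, hc, inv_mul_cancel_left₀ hcard]

end Tsirelson

/-- Real parts of inner products of vectors of norm at most `1` are quantum correlations with
uniform marginals. -/
theorem uniformMarginals_re_inner_mem_quantumSet {X Y K : Type*} [Finite X] [Finite Y]
    [NormedAddCommGroup K] [InnerProductSpace ℂ K] {u : X → K} {v : Y → K}
    (hu : ∀ x, ‖u x‖ ≤ 1) (hv : ∀ y, ‖v y‖ ≤ 1) :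
    uniformMarginals (fun x y => (inner ℂ (u x) (v y)).re) ∈ quantumSet X Y ℤˣ ℤˣ := by
  -- Over `ℝ` the real part is itself the inner product, and finitely many vectors span a
  -- finite-dimensional real space.
  let _ : InnerProductSpace ℝ K := InnerProductSpace.complexToReal
  let V : Submodule ℝ K := Submodule.span ℝ (Set.range u ∪ Set.range v)
  have : FiniteDimensional ℝ V :=
    FiniteDimensional.span_of_finite ℝ ((Set.finite_range u).union (Set.finite_range v))
  let u' : X → V := fun x => ⟨u x, Submodule.subset_span (Or.inl ⟨x, rfl⟩)⟩
  let v' : Y → V := fun y => ⟨v y, Submodule.subset_span (Or.inr ⟨y, rfl⟩)⟩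
  let b := (stdOrthonormalBasis ℝ V).repr
  have hb : ∀ w : V, ∑ i, b w i ^ 2 = ‖w‖ ^ 2 := fun w => by
    rw [← b.norm_map w, EuclideanSpace.real_norm_sq_eq]
  have hin : ∀ x y, ∑ i, b (u' x) i * b (v' y) i = (inner ℂ (u x) (v y)).re := fun x y => by
    have h1 : inner ℝ (u' x) (v' y) = (inner ℂ (u x) (v y)).re := rfl
    rw [← h1, ← b.inner_map_map, PiLp.inner_apply]
    exact Finset.sum_congr rfl fun i _ => by simp [mul_comm]
  have sq_le : ∀ w : V, ‖w‖ ≤ 1 → 0 ≤ 1 - ‖w‖ ^ 2 := fun w hw => by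
    have := pow_le_one₀ (norm_nonneg w) hw (n := 2)
    linarith
  -- Two extra coordinates, one for each player, raise all norms to `1` and leave the products
  -- between Alice's and Bob's vectors unchanged.
  refine uniformMarginals_mem_quantumSet_of_unit
    (u := fun x => Fin.cons (Real.sqrt (1 - ‖u' x‖ ^ 2)) (Fin.cons 0 (b (u' x))))
    (v := fun y => Fin.cons 0 (Fin.cons (Real.sqrt (1 - ‖v' y‖ ^ 2)) (b (v' y))))
    (fun x => ?_) (fun y => ?_) fun x y => ?_
  · simp only [Fin.sum_univ_succ, Fin.cons_zero, Fin.cons_succ, hb,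
      Real.sq_sqrt (sq_le (u' x) (hu x))]
    ring
  · simp only [Fin.sum_univ_succ, Fin.cons_zero, Fin.cons_succ, hb,
      Real.sq_sqrt (sq_le (v' y) (hv y))]
    ring
  · simp only [Fin.sum_univ_succ, Fin.cons_zero, Fin.cons_succ, hin]
    ring

end

noncomputable section

/-! ### Correlations of quantum protocols -/

/-- For `D = ∑ s_a E_a ψ` and `k_a = √E_a`, one has `‖D‖² = ∑ s_a Re ⟨k_a D, k_a ψ⟩ ≤ ½ ∑ ‖k_a D‖² +
½ ∑ ‖k_a ψ‖²`. The first sum is at most `‖D‖²` because `∑ E_a ≤ 1`, and can be absorbed on the left.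
-/
theorem norm_sum_smul_sq_le {A H : Type*} [Fintype A] [NormedAddCommGroup H]
    [InnerProductSpace ℂ H] [CompleteSpace H] {E : A → H →L[ℂ] H} (hE : ∀ a, 0 ≤ E a)
    (hE1 : ∑ a, E a ≤ 1) {s : A → ℝ} (hs : ∀ a, |s a| ≤ 1) (ψ : H) :
    ‖∑ a, (s a : ℂ) • E a ψ‖ ^ 2 ≤ (∑ a, inner ℂ ψ (E a ψ)).re := by
  set D := ∑ a, (s a : ℂ) • E a ψ with hD
  let k : A → H →L[ℂ] H := fun a => CFC.sqrt (E a)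
  have hk : ∀ a φ χ, inner ℂ φ (E a χ) = inner ℂ (k a φ) (k a χ) := fun a φ χ => by
    have h1 : star (k a) = k a := (IsSelfAdjoint.of_nonneg (CFC.sqrt_nonneg (E a))).star_eq
    have h2 : k a * k a = E a := CFC.sqrt_mul_sqrt_self _ (hE a)
    rw [← h2, mul_apply_eq_comp]
    nth_rewrite 1 [← h1]
    rw [ContinuousLinearMap.star_eq_adjoint, ContinuousLinearMap.adjoint_inner_right]
  have hsq : ∀ a φ, (inner ℂ φ (E a φ)).re = ‖k a φ‖ ^ 2 := fun a φ => by
    rw [hk]; exact inner_self_eq_norm_sq (𝕜 := ℂ) (k a φ)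
  have hle : ∑ a, ‖k a D‖ ^ 2 ≤ ‖D‖ ^ 2 := by
    have h := ((ContinuousLinearMap.le_def _ _).1 hE1).re_inner_nonneg_right D
    rw [sub_apply, inner_sub_right, map_sub, one_apply_eq_self, inner_self_eq_norm_sq, sum_apply,
      inner_sum, map_sum] at h
    simp only [RCLike.re_to_complex, hsq] at h
    linarith
  have hnorm : ‖D‖ ^ 2 ≤ ∑ a, (‖k a D‖ ^ 2 + ‖k a ψ‖ ^ 2) / 2 := by
    have h : ‖D‖ ^ 2 = ∑ a, s a * (inner ℂ (k a D) (k a ψ)).re := by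
      rw [← inner_self_eq_norm_sq (𝕜 := ℂ) D]
      nth_rewrite 2 [hD]
      rw [inner_sum, map_sum]
      refine Finset.sum_congr rfl fun a _ => ?_
      rw [inner_smul_right, hk]
      exact Complex.re_ofReal_mul _ _
    rw [h]
    refine Finset.sum_le_sum fun a _ => ?_
    have h1 : |(inner ℂ (k a D) (k a ψ)).re| ≤ ‖k a D‖ * ‖k a ψ‖ :=
      (Complex.abs_re_le_norm _).trans (norm_inner_le_norm _ _)
    calc s a * (inner ℂ (k a D) (k a ψ)).re ≤ |s a * (inner ℂ (k a D) (k a ψ)).re| := le_abs_self _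
      _ = |s a| * |(inner ℂ (k a D) (k a ψ)).re| := abs_mul _ _
      _ ≤ 1 * (‖k a D‖ * ‖k a ψ‖) := by gcongr; exact hs a
      _ ≤ _ := by nlinarith [sq_nonneg (‖k a D‖ - ‖k a ψ‖)]
  rw [← Finset.sum_div, Finset.sum_add_distrib] at hnorm
  rw [Complex.re_sum]
  simp only [hsq]
  linarith

/-- The correlations of a binary distribution. -/
def correlation {X Y : Type*} (p : Table X Y ℤˣ ℤˣ) (x : X) (y : Y) : ℝ :=
  ∑ a : ℤˣ, ∑ b : ℤˣ, ((a : ℤ) : ℝ) * ((b : ℤ) : ℝ) * p x y a b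

/-- The local success probabilities `1 / d ^ 2` and `1 / d' ^ 2` permit rescaling by `d` and `d'`.
As `d d' = 2 ^ q`, half of the exponent in the factor `4 ^ q` is saved. -/
theorem QuantumSim.exists_correlation_vectors {X Y : Type*} {q : ℕ} {p : Table X Y ℤˣ ℤˣ}
    (h : QuantumSim q p) :
    ∃ (H : Type) (_ : NormedAddCommGroup H) (_ : InnerProductSpace ℂ H) (u : X → H) (v : Y → H),
      (∀ x, ‖u x‖ ≤ 1) ∧ (∀ y, ‖v y‖ ≤ 1) ∧
      ∀ x y, correlation p x y = 2 ^ q * (inner ℂ (u x) (v y)).re := by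
  obtain ⟨H, _, _, _, ψ, E, F, d, d', hψ, hd, hd', hdd, hE, hE1, hF, hF1, hc, hpv, hEd, hFd⟩ :=
    h.exists_subPOVM
  have habs : ∀ a : ℤˣ, |((a : ℤ) : ℝ)| ≤ 1 := fun a => by
    rcases Int.units_eq_one_or a with rfl | rfl <;> simp
  have hnorm : ∀ {r : ℝ} {w : H}, 0 < r → ‖w‖ ^ 2 ≤ (r ^ 2)⁻¹ → ‖(r : ℂ) • w‖ ≤ 1 := by
    intro r w hr hw
    rw [norm_smul, Complex.norm_real, Real.norm_of_nonneg hr.le]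
    have h1 : (r * ‖w‖) ^ 2 ≤ 1 := by
      rw [mul_pow]
      calc r ^ 2 * ‖w‖ ^ 2 ≤ r ^ 2 * (r ^ 2)⁻¹ := by gcongr
        _ = 1 := mul_inv_cancel₀ (by positivity)
    exact (pow_le_one_iff_of_nonneg (by positivity) two_ne_zero).1 h1
  refine ⟨H, inferInstance, inferInstance,
    fun x => (d : ℂ) • ∑ a : ℤˣ, (((a : ℤ) : ℝ) : ℂ) • E x a ψ,
    fun y => (d' : ℂ) • ∑ b : ℤˣ, (((b : ℤ) : ℝ) : ℂ) • F y b ψ,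
    fun x => hnorm hd ?_, fun y => hnorm hd' ?_, fun x y => ?_⟩
  · refine (norm_sum_smul_sq_le (hE x) (hE1 x) habs ψ).trans (le_of_eq ?_)
    rw [hEd, Complex.ofReal_re]
  · refine (norm_sum_smul_sq_le (hF y) (hF1 y) habs ψ).trans (le_of_eq ?_)
    rw [hFd, Complex.ofReal_re]
  · have hEF : ∀ a b, inner ℂ ψ ((E x a * F y b) ψ) = inner ℂ (E x a ψ) (F y b ψ) := fun a b => by
      have h1 : star (E x a) = E x a := (IsSelfAdjoint.of_nonneg (hE x a)).star_eq
      nth_rewrite 1 [← h1]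
      rw [mul_apply_eq_comp, ContinuousLinearMap.star_eq_adjoint,
        ContinuousLinearMap.adjoint_inner_right]
    have key : (correlation p x y : ℂ) = 4 ^ q * inner ℂ (∑ a : ℤˣ, (((a : ℤ) : ℝ) : ℂ) • E x a ψ)
        (∑ b : ℤˣ, (((b : ℤ) : ℝ) : ℂ) • F y b ψ) := by
      rw [correlation, sum_inner, Complex.ofReal_sum, Finset.mul_sum]
      refine Finset.sum_congr rfl fun a _ => ?_
      rw [inner_sum, Complex.ofReal_sum, Finset.mul_sum]
      refine Finset.sum_congr rfl fun b _ => ?_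
      rw [Complex.ofReal_mul, hpv, hEF, inner_smul_left, inner_smul_right, Complex.conj_ofReal,
        Complex.ofReal_mul]
      ring
    have key2 : (correlation p x y : ℂ) = ((2 ^ q : ℝ) : ℂ) *
        inner ℂ ((d : ℂ) • ∑ a : ℤˣ, (((a : ℤ) : ℝ) : ℂ) • E x a ψ)
          ((d' : ℂ) • ∑ b : ℤˣ, (((b : ℤ) : ℝ) : ℂ) • F y b ψ) := by
      have hddC : (d : ℂ) * d' = 2 ^ q := by exact_mod_cast hdd
      rw [key, inner_smul_left, inner_smul_right, Complex.conj_ofReal, ← mul_assoc (d : ℂ), hddC,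
        show (4 : ℂ) = 2 * 2 by norm_num, mul_pow]
      push_cast
      ring
    have := congrArg Complex.re key2
    rwa [Complex.ofReal_re, Complex.re_ofReal_mul] at this

theorem gammaTilde_uniformMarginals_correlation_le {X Y : Type*} [Finite X] [Finite Y] {q : ℕ}
    {p : Table X Y ℤˣ ℤˣ} (h : QuantumSim q p) :
    gammaTilde (uniformMarginals (correlation p)) ≤ 2 ^ q := by
  obtain ⟨H, _, _, u, v, hu, hv, huv⟩ := h.exists_correlation_vectors
  have h1 : (1 : ℝ) ≤ 2 ^ q := one_le_pow₀ (by norm_num)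
  have hpos := uniformMarginals_re_inner_mem_quantumSet hu hv
  have hneg := uniformMarginals_re_inner_mem_quantumSet (v := fun y => -v y) hu
    (fun y => by rw [norm_neg]; exact hv y)
  -- The weights sum to `1`, which preserves the uniform marginals; their difference `2 ^ q` scales
  -- the correlations and is also the sum of their absolute values.
  refine (affineCost_le ![(1 + 2 ^ q) / 2, (1 - 2 ^ q) / 2]
    ![uniformMarginals fun x y => (inner ℂ (u x) (v y)).re,
      uniformMarginals fun x y => (inner ℂ (u x) (-v y)).re] ?_ ?_).trans (le_of_eq ?_)
  · intro i
    fin_cases i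
    exacts [hpos, hneg]
  · ext x y a b
    simp only [Fin.sum_univ_two, Matrix.cons_val_zero, Matrix.cons_val_one, Pi.add_apply,
      Pi.smul_apply, smul_eq_mul, uniformMarginals, huv, inner_neg_right, Complex.neg_re]
    ring
  · simp only [Fin.sum_univ_two, Matrix.cons_val_zero, Matrix.cons_val_one]
    rw [abs_of_nonneg (by positivity), abs_of_nonpos (by linarith)]
    ring

theorem sum_units_int {E : Type*} [AddCommMonoid E] (f : ℤˣ → E) : ∑ a, f a = f 1 + f (-1) := by
  rw [show (Finset.univ : Finset ℤˣ) = {1, -1} from rfl, Finset.sum_pair (by decide)]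

theorem correlation_uniformMarginals {X Y : Type*} (C : X → Y → ℝ) :
    correlation (uniformMarginals C) = C := by
  ext x y
  simp only [correlation, uniformMarginals, sum_units_int, Units.val_one, Units.val_neg,
    Int.cast_one, Int.cast_neg]
  ring

theorem nonSignaling_uniformMarginals {X Y : Type*} {C : X → Y → ℝ}
    (hC : ∀ x y, C x y ∈ Set.Icc (-1 : ℝ) 1) : NonSignaling (uniformMarginals C) := by
  refine ⟨fun x y a b => ?_, fun x y => ?_, fun a x y y' => ?_, fun b x x' y => ?_⟩
  · obtain ⟨h1, h2⟩ := hC x y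
    rcases Int.units_eq_one_or a with rfl | rfl <;> rcases Int.units_eq_one_or b with rfl | rfl <;>
      simp [uniformMarginals] <;> linarith
  all_goals
    simp only [uniformMarginals, sum_units_int, Units.val_one, Units.val_neg,
      Int.cast_one, Int.cast_neg]
    ring

theorem NonSignaling.correlation_mem {X Y : Type*} {p : Table X Y ℤˣ ℤˣ} (hp : NonSignaling p)
    (x : X) (y : Y) : correlation p x y ∈ Set.Icc (-1 : ℝ) 1 := by
  have h := hp.sum_eq_one x y
  have h1 := hp.nonneg x y 1 1
  have h2 := hp.nonneg x y 1 (-1)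
  have h3 := hp.nonneg x y (-1) 1
  have h4 := hp.nonneg x y (-1) (-1)
  simp only [correlation, sum_units_int, Units.val_one, Units.val_neg,
    Int.cast_one, Int.cast_neg, Set.mem_Icc] at h ⊢
  constructor <;> linarith

theorem abs_sub_le_tvDist {X Y A B : Type*} [Finite X] [Finite Y] [Finite A] [Finite B]
    (p p' : Table X Y A B) (x : X) (y : Y) (s : Finset (A × B)) :
    |∑ e ∈ s, p x y e.1 e.2 - ∑ e ∈ s, p' x y e.1 e.2| ≤ tvDist p p' :=
  le_ciSup (f := fun z : X × Y × Finset (A × B) =>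
    |∑ e ∈ z.2.2, p z.1 z.2.1 e.1 e.2 - ∑ e ∈ z.2.2, p' z.1 z.2.1 e.1 e.2|)
    (Set.finite_range _).bddAbove (x, y, s)

/-- Replacing a binary distribution by the one with the same correlations and uniform marginals
does not increase its distance to a distribution with uniform marginals. -/
theorem tvDist_uniformMarginals_correlation_le {X Y : Type*} [Finite X] [Finite Y] [Nonempty X]
    [Nonempty Y] (C : X → Y → ℝ) {p : Table X Y ℤˣ ℤˣ} (hp : NonSignaling p) :
    tvDist (uniformMarginals C) (uniformMarginals (correlation p)) ≤
      tvDist (uniformMarginals C) p := by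
  refine ciSup_le fun ⟨x, y, s⟩ => ?_
  -- The symmetrized table is the average of `p` and its joint flip, and `uniformMarginals C` is
  -- flip-invariant. Hence the deviation on `s` is the average of the deviations of `p` on `s` and
  -- on the flipped event.
  let s' := s.map ((Equiv.neg ℤˣ).prodCongr (Equiv.neg ℤˣ)).toEmbedding
  have h1 := abs_sub_le_tvDist (uniformMarginals C) p x y s
  have h2 := abs_sub_le_tvDist (uniformMarginals C) p x y s'
  have hs : ∀ f : ℤˣ → ℤˣ → ℝ, ∑ e ∈ s', f e.1 e.2 = ∑ e ∈ s, f (-e.1) (-e.2) := fun f => by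
    rw [Finset.sum_map]; rfl
  rw [hs, hs] at h2
  have hp1 := hp.sum_eq_one x y
  have hsym : ∀ a b, uniformMarginals (correlation p) x y a b =
      (p x y a b + p x y (-a) (-b)) / 2 := by
    simp only [sum_units_int] at hp1
    intro a b
    rcases Int.units_eq_one_or a with rfl | rfl <;> rcases Int.units_eq_one_or b with rfl | rfl <;>
      simp only [uniformMarginals, correlation, sum_units_int, Units.val_one, Units.val_neg,
        Int.cast_one, Int.cast_neg, neg_neg] <;> linarith
  have hC : ∀ a b, uniformMarginals C x y (-a) (-b) = uniformMarginals C x y a b := fun a b => by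
    simp [uniformMarginals]
  simp only [hC] at h2
  simp only [hsym, ← Finset.sum_div, Finset.sum_add_distrib]
  rw [abs_le] at h1 h2 ⊢
  constructor <;> linarith

/-! ### Lower bounds for communication -/

/-- Rounding up puts the bound into `ℕ∞`, where it can be compared with an infimum that may be `⊤`.
-/
theorem coe_le_of_ceil_le {r : ℝ} {N : ℕ∞} (h : (⌈r⌉₊ : ℕ∞) ≤ N) :
    (r : EReal) ≤ ((N : ENNReal) : EReal) := by
  have h1 : ((⌈r⌉₊ : ENNReal) : EReal) ≤ ((N : ENNReal) : EReal) := by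
    rw [EReal.coe_ennreal_le_coe_ennreal_iff]
    exact_mod_cast ENat.toENNReal_le.2 h
  refine le_trans ?_ h1
  rw [← ENNReal.coe_natCast]
  exact EReal.coe_le_coe_iff.2 (Nat.le_ceil r)

theorem le_exactComplexity {X Y A B : Type*} {Sim : ℕ → Table X Y A B → Prop} {p : Table X Y A B}
    {r : ℝ} (h : ∀ t, Sim t p → r ≤ t) :
    (r : EReal) ≤ ((exactComplexity Sim p : ENNReal) : EReal) :=
  coe_le_of_ceil_le <| le_iInf₂ fun t ht => by exact_mod_cast Nat.ceil_le.2 (h t ht)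

theorem le_approxComplexity {X Y A B : Type*} [Fintype A] [Fintype B]
    {Sim : ℕ → Table X Y A B → Prop} {p : Table X Y A B} {ε r : ℝ}
    (h : ∀ p' t, NonSignaling p' → tvDist p p' ≤ ε → Sim t p' → r ≤ t) :
    (r : EReal) ≤ ((approxComplexity Sim ε p : ENNReal) : EReal) :=
  coe_le_of_ceil_le <| le_iInf fun p' => le_iInf₂ fun hp' hε => le_iInf₂ fun t ht => by
    exact_mod_cast Nat.ceil_le.2 (h p' t hp' hε ht)

theorem logb_two_le_of_le_pow {x : ℝ} (hx : 0 ≤ x) {n : ℕ} (h : x ≤ 2 ^ n) : Real.logb 2 x ≤ n := by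
  rcases hx.eq_or_lt with rfl | hpos
  -- At `x = 0` the convention `Real.logb 2 0 = 0` makes the bound trivial.
  · simp
  · rw [Real.logb_le_iff_le_rpow (by norm_num) hpos, Real.rpow_natCast]
    exact h

theorem logb_two_sub_one_le {x : ℝ} (hx : 0 ≤ x) {t : ℕ} (h : x ≤ 2 * 2 ^ t - 1) :
    Real.logb 2 x - 1 ≤ t := by
  have := logb_two_le_of_le_pow hx (n := t + 1) (by rw [pow_succ]; linarith)
  push_cast at this
  linarith

theorem half_logb_two_sub_one_le {x : ℝ} (hx : 0 ≤ x) {q : ℕ} (h : x ≤ 2 * 4 ^ q - 1) :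
    1 / 2 * Real.logb 2 x - 1 ≤ q := by
  have h4 : (4 : ℝ) ^ q = 2 ^ (2 * q) := by rw [pow_mul]; norm_num
  have := logb_two_le_of_le_pow hx (n := 2 * q + 1) (by rw [pow_succ, ← h4]; linarith)
  push_cast at this
  linarith

end

theorem mainTheorem2 {X Y A B : Type*} [Fintype X] [Fintype Y] [Fintype A] [Fintype B]
    [Nonempty X] [Nonempty Y]
    (p : Table X Y A B) (hp : NonSignaling p)
    (C : X → Y → ℝ) (hC : ∀ x y, C x y ∈ Set.Icc (-1 : ℝ) 1)
    (ε : ℝ) (hε : 0 ≤ ε) :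
    (((Real.logb 2 (nuTilde p) - 1 : ℝ) : EReal) ≤ ((R0pub p : ENNReal) : EReal) ∧
      ((Real.logb 2 (nuTildeApprox ε p) - 1 : ℝ) : EReal) ≤ ((Rpub ε p : ENNReal) : EReal)) ∧
    (((1 / 2 * Real.logb 2 (gammaTilde p) - 1 : ℝ) : EReal) ≤ ((Q0ent p : ENNReal) : EReal) ∧
      ((1 / 2 * Real.logb 2 (gammaTildeApprox ε p) - 1 : ℝ) : EReal) ≤
        ((Qent ε p : ENNReal) : EReal)) ∧
    (((Real.logb 2 (gammaTilde (uniformMarginals C)) : ℝ) : EReal) ≤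
        ((Q0ent (uniformMarginals C) : ENNReal) : EReal) ∧
      ((Real.logb 2 (gammaTildeApprox ε (uniformMarginals C)) : ℝ) : EReal) ≤
        ((Qent ε (uniformMarginals C) : ENNReal) : EReal)) := by
  refine ⟨⟨le_exactComplexity fun t ht => ?_, le_approxComplexity fun p' t hp' hd ht => ?_⟩,
    ⟨le_exactComplexity fun q hq => ?_, le_approxComplexity fun p' q hp' hd hq => ?_⟩,
    le_exactComplexity fun q hq => ?_, le_approxComplexity fun p' q hp' hd hq => ?_⟩
  · exact logb_two_sub_one_le (affineCost_nonneg _ _) (nuTilde_le_of_classicalSim hp ht)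
  · exact logb_two_sub_one_le (affineCostApprox_nonneg _ _ _)
      ((affineCostApprox_le _ hp' hd).trans (nuTilde_le_of_classicalSim hp' ht))
  · exact half_logb_two_sub_one_le (affineCost_nonneg _ _) (gammaTilde_le_of_quantumSim hp hq)
  · exact half_logb_two_sub_one_le (affineCostApprox_nonneg _ _ _)
      ((affineCostApprox_le _ hp' hd).trans (gammaTilde_le_of_quantumSim hp' hq))
  · refine logb_two_le_of_le_pow (affineCost_nonneg _ _) ?_
    have := gammaTilde_uniformMarginals_correlation_le hq
    rwa [correlation_uniformMarginals] at this
  -- The simulated `p'` need not have uniform marginals. Its symmetrization is still within `ε` of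
  -- `C` and competes in the infimum in its place.
  · exact logb_two_le_of_le_pow (affineCostApprox_nonneg _ _ _)
      ((affineCostApprox_le _ (nonSignaling_uniformMarginals hp'.correlation_mem)
        ((tvDist_uniformMarginals_correlation_le C hp').trans hd)).trans
        (gammaTilde_uniformMarginals_correlation_le hq))
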